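/- **Setting.** Let $\mathcal G=(\mathcal S,\mathcal N,\{\mathcal A_i,R_i\}_{i\in\mathcal N},P,\gamma,\rho)$ be a finite multi-agent Markov decision process: a finite nonempty set $\mathcal N$ of $n$ agents, a finite state space with $S=|\mathcal S|$, finite nonempty action sets $\mathcal A_i$ with $A_{\max}=\max_i|\mathcal A_i|$, $\mathcal A=\prod_i\mathcal A_i$, rewards $R_i:\mathcal S\times\mathcal A\to[-1,1]$, transition probabilities $P(\cdot\mid s,\mathbf a)$, discount factor $\gamma\in[0,1)$, and distribution $\rho\in\Delta(\mathcal S)$ of the initial state of the sampled trajectories. A joint policy is $\pi=(\pi_i)_i\in\Pi=\prod_i\Delta(\mathcal A_i)^{\mathcal S}$; agents randomize independently. Let $V^i_s(\pi)=\sum_{t\ge0}\gamma^t\,\mathbb E_\pi[R_i(s_t,\mathbf a_t)\mid s_0=s]$, $V^i_\nu(\pi)=\sum_s\nu(s)V^i_s(\pi)$ and $d^\pi_\nu(s)=(1-\gamma)\sum_{t\ge0}\gamma^t\Pr^\pi(s_t=s\mid s_0\sim\nu)$. Assume $\mathcal G$ is a Markov potential game: there are functions $\Phi_s:\Pi\to\mathbb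 R$ with $$\Phi_s(\pi_i,\pi_{-i})-\Phi_s(\pi_i',\pi_{-i})=V^i_s(\pi_i,\pi_{-i})-V^i_s(\pi'_i,\pi_{-i})$$ for all $i$, $s$, $\pi_i,\pi_i'$, $\pi_{-i}$. Put $\Phi_\rho=\sum_s\rho(s)\Phi_s$ and $\Phi_{\max}=\sup_\Pi\Phi_\rho-\inf_\Pi\Phi_\rho$ (the maximum of $\Phi_\rho$ when it is shifted to have minimum $0$). Let $I\subseteq\Delta(\mathcal S)$ be any nonempty set of initial distributions at which play is evaluated ($I=\{\rho\}$, or a single arbitrary initial state, or all of $\Delta(\mathcal S)$, are examples). A joint policy $\pi$ is an $\epsilon$-Nash policy (from $I$) if $V^i_\nu(\pi)\ge V^i_\nu(\pi_i',\pi_{-i})-\epsilon$ for all $i$, all $\pi'_i$ and all $\nu\in I$; for $I=\Delta(\mathcal S)$ this is the same as requiring it from every state. Let $\mathrm{gap}(\pi)$ be the least $\epsilon\ge0$ for which $\pi$ is an $\epsilon$-Nash policy. Assume that $\rho(s)=0$ implies $d^\pi_\nu(s)=0$ for all $\pi\in\Pi$, $\nu\in I$, and let $D=\sup_{\nu\in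 I,\,\pi\in\Pi}\|d^\pi_\nu/\rho\|_\infty$ be the distribution mismatch coefficient (with $0/0=0$). **Algorithm.** For $\alpha\in[0,1]$ the $\alpha$-greedy policy with parameter $x_i\in\Delta(\mathcal A_i)^{\mathcal S}$ is $\pi_{i}(a\mid s)=(1-\alpha)x_{i,s,a}+\alpha/|\mathcal A_i|$. Start from an arbitrary parameter $x^{(0)}$. At iteration $t$, with $\pi^{(t)}$ the $\alpha$-greedy joint policy of $x^{(t)}$, draw a horizon $K$ with $\Pr(K=k)=(1-\gamma)\gamma^k$, $k\ge0$, and, independently of it, a trajectory $s_0,\mathbf a_0,\dots,s_K,\mathbf a_K$ of $\pi^{(t)}$ with $s_0\sim\rho$ (fresh randomness at each iteration), and let all agents update simultaneously by $$\hat\nabla_i^{(t)}=\Big(\sum_{k=0}^KR_i(s_k,\mathbf a_k)\Big)\sum_{k=0}^K\nabla_{x_i}\log\pi^{(t)}_i(a_{i,k}\mid s_k),\qquad x_i^{(t+1)}=P_{\Delta(\mathcal A_i)^{\mathcal S}}\big(x_i^{(t)}+\eta\hat\nabla_i^{(t)}\big),$$ where $P$ is Euclidean projection. **Theorem.** Let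 $0<\epsilon\le(1-\gamma)^2/4$, $\alpha=\epsilon^2$, and $$\eta=\frac{\epsilon^4(1-\gamma)^9}{10^5\,n^2A_{\max}^3D^2S},\qquad T=\max\left\{1,\left\lceil\frac{10^8\,n^2A_{\max}^3\Phi_{\max}D^4S^2}{(1-\gamma)^{11}\,\epsilon^6}\right\rceil\right\}=O(1/\epsilon^6).$$ Then for every $x^{(0)}$ there is $t\in\{1,\dots,T\}$ such that $\pi^{(t)}$ is in expectation an $\epsilon$-Nash policy, i.e. $\mathbb E\big[\mathrm{gap}(\pi^{(t)})\big]\le\epsilon$. -/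

import Mathlib

namespace MarkovGame

noncomputable section

/-- A finite discounted multi-agent Markov decision process with agents `N`, states `S` and action
sets `A i`: rewards in `[-1, 1]`, transition probabilities, a discount factor in `[0, 1)` and a
distribution of the state at time `0`. -/
structure Game (N S : Type*) (A : N → Type*) where
  /-- `reward i s a` is the instantaneous reward of agent `i` at state `s`, action profile `a`. -/
  reward : N → S → (∀ i, A i) → ℝ
  abs_reward_le : ∀ i s a, |reward i s a| ≤ 1
  /-- `trans s a` is the law of the next state. -/
  trans : S → (∀ i, A i) → PMF S
  discount : ℝ
  discount_nonneg : 0 ≤ discount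
  discount_lt_one : discount < 1
  /-- The law of the initial state of the sampled trajectories. -/
  init : PMF S

theorem Game.hasSum_geometric {N S : Type*} {A : N → Type*} (G : Game N S A) :
    HasSum (fun k : ℕ => ENNReal.ofReal ((1 - G.discount) * G.discount ^ k)) 1 := by
  have h0 := G.discount_nonneg
  have h1 := G.discount_lt_one
  have hs : HasSum (fun k : ℕ => (1 - G.discount) * G.discount ^ k) 1 := by
    have h := (hasSum_geometric_of_lt_one h0 h1).mul_left (1 - G.discount)
    rwa [mul_inv_cancel₀ (by linarith)] at h
  have hn : ∀ k : ℕ, 0 ≤ (1 - G.discount) * G.discount ^ k := fun k =>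
    mul_nonneg (by linarith) (pow_nonneg h0 k)
  have h := ENNReal.ofReal_tsum_of_nonneg hn hs.summable
  rw [hs.tsum_eq, ENNReal.ofReal_one] at h
  rw [h]
  exact ENNReal.summable.hasSum

/-- The geometric law of the time horizon: the play continues after each step with probability
`discount`. -/
def Game.horizonLaw {N S : Type*} {A : N → Type*} (G : Game N S A) : PMF ℕ :=
  ⟨fun k => ENNReal.ofReal ((1 - G.discount) * G.discount ^ k), G.hasSum_geometric⟩

/-- `Δ(B)^S`, as a subset of the Euclidean space `ℝ^(S × B)`. -/
def policySet (S B : Type*) [Fintype B] : Set (EuclideanSpace ℝ (S × B)) :=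
  {x | (∀ s b, 0 ≤ x (s, b)) ∧ ∀ s, ∑ b, x (s, b) = 1}

/-- Stationary randomized policies of an agent with action set `B`. -/
abbrev Policy (S B : Type*) [Fintype B] : Type _ := {x // x ∈ policySet S B}

theorem policySet_nonempty (S B : Type*) [Fintype B] [Nonempty B] : (policySet S B).Nonempty := by
  classical
  obtain ⟨b₀⟩ := ‹Nonempty B›
  refine ⟨WithLp.toLp 2 fun z => if z.2 = b₀ then 1 else 0, fun s b => ?_, fun s => ?_⟩
  · dsimp only
    split_ifs <;> norm_num
  · simp

theorem isClosed_policySet (S B : Type*) [Fintype B] : IsClosed (policySet S B) := by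
  have h : policySet S B = (⋂ s, ⋂ b, {x | 0 ≤ x (s, b)}) ∩ ⋂ s, {x | ∑ b, x (s, b) = 1} := by
    ext x
    simp [policySet]
  rw [h]
  refine IsClosed.inter (isClosed_iInter fun s => isClosed_iInter fun b => ?_)
    (isClosed_iInter fun s => ?_)
  · exact isClosed_le continuous_const (by fun_prop)
  · exact isClosed_eq (by fun_prop) continuous_const

theorem exists_closest_policy {S B : Type*} [Fintype S] [Fintype B] [Nonempty B]
    (v : EuclideanSpace ℝ (S × B)) :
    ∃ x : Policy S B, ∀ y : Policy S B, ‖v - x.1‖ ≤ ‖v - y.1‖ := by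
  obtain ⟨x, hx, hd⟩ :=
    (isClosed_policySet S B).exists_infDist_eq_dist (policySet_nonempty S B) v
  refine ⟨⟨x, hx⟩, fun y => ?_⟩
  rw [← dist_eq_norm, ← dist_eq_norm, ← hd]
  exact Metric.infDist_le_dist_of_mem y.2

/-- Euclidean projection onto `Δ(B)^S`. -/
def proj {S B : Type*} [Fintype S] [Fintype B] [Nonempty B] (v : EuclideanSpace ℝ (S × B)) :
    Policy S B :=
  (exists_closest_policy v).choose

/-- The `α`-greedy policy `(1 - α) x + α / |B|` with parameter `x`. -/
def greedy {S B : Type*} [Fintype B] [Nonempty B] (α : ℝ) (hα : α ∈ Set.Icc (0 : ℝ) 1)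
    (x : Policy S B) : Policy S B :=
  ⟨WithLp.toLp 2 fun z => (1 - α) * x.1 z + α / Fintype.card B, by
    have hc : (0 : ℝ) < Fintype.card B := by exact_mod_cast Fintype.card_pos
    refine ⟨fun s b => ?_, fun s => ?_⟩
    · exact add_nonneg (mul_nonneg (by linarith [hα.2]) (x.2.1 s b)) (div_nonneg hα.1 hc.le)
    · simp only [Finset.sum_add_distrib, ← Finset.mul_sum, x.2.2 s, Finset.sum_const,
        Finset.card_univ, nsmul_eq_mul]
      field_simp
      ring⟩

variable {N S : Type*} {A : N → Type*} [Fintype N] [DecidableEq N] [Fintype S]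
  [∀ i, Fintype (A i)]

/-- A joint policy: one policy per agent; the agents randomize independently. -/
abbrev JointPolicy (N S : Type*) (A : N → Type*) [∀ i, Fintype (A i)] : Type _ :=
  ∀ i : N, Policy S (A i)

/-- The law of the action profile drawn at state `s`: the product of the agents' policies. -/
def actionLaw (π : JointPolicy N S A) (s : S) : PMF (∀ i, A i) :=
  PMF.ofFintype (fun a => ∏ i, ENNReal.ofReal ((π i).1 (s, a i))) (by
    rw [← Fintype.prod_sum fun i (b : A i) => ENNReal.ofReal ((π i).1 (s, b))]
    refine Finset.prod_eq_one fun i _ => ?_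
    rw [← ENNReal.ofReal_sum_of_nonneg fun b _ => (π i).2.1 s b, (π i).2.2 s, ENNReal.ofReal_one])

namespace Game

variable (G : Game N S A)

/-- The law of the state at time `t` when the initial state has law `ν` and `π` is played. -/
def stateLaw (π : JointPolicy N S A) (ν : PMF S) : ℕ → PMF S
  | 0 => ν
  | t + 1 => (stateLaw π ν t).bind fun s => (actionLaw π s).bind (G.trans s)

/-- The expected reward of agent `i` at time `t`. -/
def expReward (i : N) (π : JointPolicy N S A) (ν : PMF S) (t : ℕ) : ℝ :=
  ∑ s, (G.stateLaw π ν t s).toReal * ∑ a, (actionLaw π s a).toReal * G.reward i s a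

/-- The value `V_s^i(π)`: the expected discounted reward of agent `i` from the state `s`. -/
def stateValue (i : N) (s : S) (π : JointPolicy N S A) : ℝ :=
  ∑' t : ℕ, G.discount ^ t * G.expReward i π (PMF.pure s) t

/-- The value `V_ν^i(π) = E_{s ∼ ν} V_s^i(π)`. -/
def value (i : N) (ν : PMF S) (π : JointPolicy N S A) : ℝ :=
  ∑ s, (ν s).toReal * G.stateValue i s π

/-- The discounted state visitation distribution `d_ν^π`. -/
def visitation (π : JointPolicy N S A) (ν : PMF S) (s : S) : ℝ :=
  (1 - G.discount) * ∑' t : ℕ, G.discount ^ t * (G.stateLaw π ν t s).toReal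

/-- `Φ` is a potential: a unilateral change of policy of any agent changes `Φ_s` by exactly as much
as it changes that agent's value at `s`, for every state `s`. -/
def IsPotential (Φ : S → JointPolicy N S A → ℝ) : Prop :=
  ∀ (i : N) (s : S) (π : JointPolicy N S A) (p q : Policy S (A i)),
    Φ s (Function.update π i p) - Φ s (Function.update π i q) =
      G.stateValue i s (Function.update π i p) - G.stateValue i s (Function.update π i q)

/-- The oscillation of `Φ_ρ = E_{s ∼ ρ} Φ_s`, `ρ` the law of the initial state; this is the maximum
of `Φ_ρ` once `Φ` is shifted by a constant so that the minimum of `Φ_ρ` is `0`. -/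
def potentialRange (Φ : S → JointPolicy N S A → ℝ) : ℝ :=
  ⨆ z : JointPolicy N S A × JointPolicy N S A,
    (∑ s, (G.init s).toReal * Φ s z.1) - ∑ s, (G.init s).toReal * Φ s z.2

/-- The distribution mismatch coefficient: the maximum of `d_ν^π(s) / ρ(s)` over all policies,
all states and all `ν ∈ I`, where `ρ` is the law of the initial state. -/
def mismatch (I : Set (PMF S)) : ℝ :=
  ⨆ z : I × JointPolicy N S A × S, G.visitation z.2.1 z.1.1 z.2.2 / (G.init z.2.2).toReal

/-- `π` is an `ε`-Nash policy when play starts from any of the initial distributions in `I`. -/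
def IsApproxNash (I : Set (PMF S)) (ε : ℝ) (π : JointPolicy N S A) : Prop :=
  ∀ (i : N) (p : Policy S (A i)), ∀ ν ∈ I,
    G.value i ν (Function.update π i p) - ε ≤ G.value i ν π

/-- The least `ε ≥ 0` for which `π` is an `ε`-Nash policy. -/
def nashGap (I : Set (PMF S)) (π : JointPolicy N S A) : ℝ :=
  sInf {ε | 0 ≤ ε ∧ G.IsApproxNash I ε π}

/-- The law of `(s_0, a_0), …, (s_k, a_k)` when `s_0 = s` and `π` is played. -/
def pathLaw (π : JointPolicy N S A) : ℕ → S → PMF (List (S × ∀ i, A i))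
  | 0, s => (actionLaw π s).map fun a => [(s, a)]
  | k + 1, s => (actionLaw π s).bind fun a => (G.trans s a).bind fun s' =>
      (pathLaw π k s').map fun l => (s, a) :: l

/-- The law of a sampled trajectory: geometric horizon, and initial state with law `G.init`. -/
def trajectoryLaw (π : JointPolicy N S A) : PMF (List (S × ∀ i, A i)) :=
  G.horizonLaw.bind fun k => G.init.bind fun s => G.pathLaw π k s

/-- The gradient estimate of agent `i` from a trajectory: its total reward times the sum of the
gradients of `log π_i(a | s)` along the trajectory, where `π_i` is the `α`-greedy policy and the
gradient is in the parameter `x` of that policy. -/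
def gradEstimate (α : ℝ) (i : N) (x : Policy S (A i)) (l : List (S × ∀ i, A i)) :
    EuclideanSpace ℝ (S × A i) :=
  (l.map fun z => G.reward i z.1 z.2).sum •
    (l.map fun z => gradient (fun y : EuclideanSpace ℝ (S × A i) =>
      Real.log ((1 - α) * y (z.1, z.2 i) + α / Fintype.card (A i))) x.1).sum

/-- One simultaneous step of projected stochastic gradient ascent with step-size `η`. -/
def step [∀ i, Nonempty (A i)] (α η : ℝ) (x : JointPolicy N S A) (l : List (S × ∀ i, A i)) :
    JointPolicy N S A :=
  fun i => proj ((x i).1 + η • G.gradEstimate α i (x i) l)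

/-- The law of the parameter after `t` steps of independent projected stochastic gradient ascent
from `x₀`; every step uses a fresh trajectory of the current `α`-greedy joint policy. -/
def iterateLaw [∀ i, Nonempty (A i)] (α : ℝ) (hα : α ∈ Set.Icc (0 : ℝ) 1) (η : ℝ)
    (x₀ : JointPolicy N S A) : ℕ → PMF (JointPolicy N S A)
  | 0 => PMF.pure x₀
  | t + 1 => (iterateLaw α hα η x₀ t).bind fun x =>
      (G.trajectoryLaw fun i => greedy α hα (x i)).map (G.step α η x)

end Game

/-- The largest number of actions of an agent. -/
def maxActions (N : Type*) (A : N → Type*) [Fintype N] [∀ i, Fintype (A i)] : ℕ :=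
  Finset.univ.sup fun i : N => Fintype.card (A i)

/-- The step-size `ε⁴ (1 - γ)⁹ / (10⁵ n² A_max³ D² S)`. -/
def stepSize (ε γ D : ℝ) (n Amax S : ℕ) : ℝ :=
  ε ^ 4 * (1 - γ) ^ 9 / (10 ^ 5 * n ^ 2 * Amax ^ 3 * D ^ 2 * S)

/-- The number of iterations: `10⁸ n² A_max³ Φ_max D⁴ S² / ((1 - γ)¹¹ ε⁶)`, rounded up, and at
least one. -/
def iterations (ε γ D Φmax : ℝ) (n Amax S : ℕ) : ℕ :=
  max 1 ⌈10 ^ 8 * n ^ 2 * Amax ^ 3 * Φmax * D ^ 4 * S ^ 2 / ((1 - γ) ^ 11 * ε ^ 6)⌉₊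

end

end MarkovGame

/-!
Precompose the potential with the greedy parametrization. By the policy gradient theorem the value
of a single agent differs from its linearization by a quadratic error, and since unilateral changes
of the potential are unilateral changes of values, the composed potential is smooth and its gradient
is assembled from the individual policy gradients. The trajectory estimates are unbiased for it, and
exploration bounds their second moment by a multiple of `1 / α`. Along projected stochastic gradient
steps the Moreau envelope of the potential therefore increases in expectation, up to noise of order
`η ^ 2`, by at least `η` times the squared distance from the iterate to its proximal point. The
envelope has bounded range, so this distance is small in mean square at some iteration.

A proximal point close to the iterate is nearly stationary. Gradient domination turns this into a
small Nash gap: the performance difference lemma expresses a deviation gain by the best advantages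
weighted by the visitation distribution of the deviating policy, and the mismatch coefficient
exchanges these weights for those of the trajectories. Values are Lipschitz in the policy, which
brings the estimate back from the proximal point to the iterate.
-/

namespace MarkovGame

noncomputable section

open scoped Matrix

section Weights

theorem abs_dotProduct_le {B : Type*} [Fintype B] (w : B → ℝ) {u : B → ℝ} {M : ℝ}
    (hu : ∀ b, |u b| ≤ M) : |w ⬝ᵥ u| ≤ (∑ b, |w b|) * M := by
  rw [Finset.sum_mul]
  refine (Finset.abs_sum_le_sum_abs _ _).trans (Finset.sum_le_sum fun b _ => ?_)
  rw [abs_mul]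
  exact mul_le_mul_of_nonneg_left (hu b) (abs_nonneg _)

theorem sum_abs_of_mem_stdSimplex {B : Type*} [Fintype B] {w : B → ℝ}
    (hw : w ∈ stdSimplex ℝ B) : ∑ b, |w b| = 1 := by
  simp only [abs_of_nonneg (hw.1 _), hw.2]

theorem abs_dotProduct_le_of_mem_stdSimplex {B : Type*} [Fintype B] {w u : B → ℝ} {M : ℝ}
    (hw : w ∈ stdSimplex ℝ B) (hu : ∀ b, |u b| ≤ M) : |w ⬝ᵥ u| ≤ M := by
  simpa [sum_abs_of_mem_stdSimplex hw] using abs_dotProduct_le w hu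

theorem dotProduct_const_of_mem_stdSimplex {B : Type*} [Fintype B] {w : B → ℝ}
    (hw : w ∈ stdSimplex ℝ B) (c : ℝ) : w ⬝ᵥ (fun _ => c) = c := by
  rw [dotProduct, ← Finset.sum_mul, hw.2, one_mul]

/-- The probability vector of `p`, with real entries. -/
def probVec {B : Type*} (p : PMF B) : B → ℝ := fun b => (p b).toReal

theorem probVec_mem_stdSimplex {B : Type*} [Fintype B] (p : PMF B) :
    probVec p ∈ stdSimplex ℝ B := by
  refine ⟨fun b => ENNReal.toReal_nonneg, ?_⟩
  simp only [probVec]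
  rw [← ENNReal.toReal_sum fun b _ => p.apply_ne_top b, ← tsum_fintype (L := .unconditional B),
    p.tsum_coe, ENNReal.toReal_one]

theorem probVec_pure_dotProduct {B : Type*} [Fintype B] (b : B) (u : B → ℝ) :
    probVec (PMF.pure b) ⬝ᵥ u = u b := by
  classical
  have h : probVec (PMF.pure b) = Pi.single b 1 := by
    funext b'
    by_cases hb : b' = b <;> simp [probVec, hb]
  rw [h, single_one_dotProduct]

theorem probVec_bind {B C : Type*} [Fintype B] (p : PMF B) (q : B → PMF C) (c : C) :
    probVec (p.bind q) c = probVec p ⬝ᵥ fun b => probVec (q b) c := by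
  simp only [probVec, dotProduct]
  rw [PMF.bind_apply, tsum_fintype, ENNReal.toReal_sum fun b _ =>
    ENNReal.mul_ne_top (p.apply_ne_top b) ((q b).apply_ne_top c)]
  simp_rw [ENNReal.toReal_mul]

end Weights

section ProductWeights

variable {ι : Type*} {B : ι → Type*} [Fintype ι]

/-- The product `a ↦ ∏ i, f i (a i)` of a family of (signed) weights. -/
def prodWeight (f : ∀ i, B i → ℝ) (a : ∀ i, B i) : ℝ := ∏ i, f i (a i)

variable [DecidableEq ι]

theorem prodWeight_update (f : ∀ i, B i → ℝ) (j : ι) (φ : B j → ℝ) (a : ∀ i, B i) :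
    prodWeight (Function.update f j φ) a = φ (a j) * ∏ i ∈ Finset.univ.erase j, f i (a i) := by
  rw [prodWeight, ← Finset.mul_prod_erase _ _ (Finset.mem_univ j), Function.update_self]
  congr 1
  exact Finset.prod_congr rfl fun i hi => by
    rw [Function.update_of_ne (Finset.ne_of_mem_erase hi)]

variable [∀ i, Fintype (B i)]

theorem sum_prodWeight (f : ∀ i, B i → ℝ) : ∑ a, prodWeight f a = ∏ i, ∑ b, f i b :=
  (Fintype.prod_sum _).symm

theorem prodWeight_mem_stdSimplex {f : ∀ i, B i → ℝ} (hf : ∀ i, f i ∈ stdSimplex ℝ (B i)) :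
    prodWeight f ∈ stdSimplex ℝ (∀ i, B i) :=
  ⟨fun a => Finset.prod_nonneg fun i _ => (hf i).1 (a i), by
    rw [sum_prodWeight]
    exact Finset.prod_eq_one fun i _ => (hf i).2⟩

theorem sum_abs_prodWeight_update (f : ∀ i, B i → ℝ) (j : ι) (φ : B j → ℝ) :
    ∑ a, |prodWeight (Function.update f j φ) a| =
      (∑ b, |φ b|) * ∏ i ∈ Finset.univ.erase j, ∑ b, |f i b| := by
  have h : ∀ a, |prodWeight (Function.update f j φ) a| =
      prodWeight (Function.update (fun i b => |f i b|) j fun b => |φ b|) a := fun a => by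
    rw [prodWeight_update, prodWeight_update, abs_mul, Finset.abs_prod]
  simp_rw [h, sum_prodWeight]
  rw [← Finset.mul_prod_erase _ _ (Finset.mem_univ j), Function.update_self]
  congr 1
  exact Finset.prod_congr rfl fun i hi => by
    rw [Function.update_of_ne (Finset.ne_of_mem_erase hi)]

theorem sum_abs_prodWeight_update_sub (f : ∀ i, B i → ℝ) (j : ι) (φ : B j → ℝ) :
    ∑ a, |prodWeight (Function.update f j φ) a - prodWeight f a| =
      (∑ b, |φ b - f j b|) * ∏ i ∈ Finset.univ.erase j, ∑ b, |f i b| := by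
  rw [← sum_abs_prodWeight_update f j fun b => φ b - f j b]
  refine Finset.sum_congr rfl fun a _ => ?_
  nth_rw 2 [← Function.update_eq_self j f]
  simp only [prodWeight_update, sub_mul]

theorem sum_abs_prodWeight_sub_le {f g : ∀ i, B i → ℝ} {c : ι → ℝ}
    (hf : ∀ i, ∑ b, |f i b| ≤ c i) (hg : ∀ i, ∑ b, |g i b| ≤ c i) :
    ∑ a, |prodWeight f a - prodWeight g a| ≤
      ∑ j, (∑ b, |f j b - g j b|) * ∏ i ∈ Finset.univ.erase j, c i := by
  suffices key : ∀ T : Finset ι, ∑ a, |prodWeight (T.piecewise f g) a - prodWeight g a| ≤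
      ∑ j ∈ T, (∑ b, |f j b - g j b|) * ∏ i ∈ Finset.univ.erase j, c i by
    simpa using key Finset.univ
  intro T
  induction T using Finset.induction_on with
  | empty => simp
  | insert j T hj ih =>
    have hc : ∀ i, ∑ b, |T.piecewise f g i b| ≤ c i := fun i => by
      by_cases hi : i ∈ T
      · simpa [hi] using hf i
      · simpa [hi] using hg i
    have hswap : ∑ a, |prodWeight ((insert j T).piecewise f g) a
        - prodWeight (T.piecewise f g) a| ≤
        (∑ b, |f j b - g j b|) * ∏ i ∈ Finset.univ.erase j, c i := by
      rw [Finset.piecewise_insert, sum_abs_prodWeight_update_sub,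
        Finset.piecewise_eq_of_notMem _ _ _ hj]
      gcongr with i
      exact hc i
    rw [Finset.sum_insert hj]
    refine le_trans ?_ (add_le_add hswap ih)
    rw [← Finset.sum_add_distrib]
    exact Finset.sum_le_sum fun a _ => abs_sub_le _ _ _

end ProductWeights

section RowNorm

variable {S B : Type*} [Fintype B]

/-- The row of `v ∈ ℝ^(S × B)` at `s`; for a policy, the distribution of the action at `s`. -/
def row (v : EuclideanSpace ℝ (S × B)) (s : S) : B → ℝ := fun b => v (s, b)

/-- The largest `ℓ¹` norm of a row of `v`; it measures how far apart two policies are. -/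
def rowNorm (v : EuclideanSpace ℝ (S × B)) : ℝ := ⨆ s, ∑ b, |row v s b|

theorem rowNorm_nonneg (v : EuclideanSpace ℝ (S × B)) : 0 ≤ rowNorm v :=
  Real.iSup_nonneg fun _ => Finset.sum_nonneg fun _ _ => abs_nonneg _

theorem rowNorm_le {v : EuclideanSpace ℝ (S × B)} {c : ℝ} (hc : 0 ≤ c)
    (h : ∀ s, ∑ b, |row v s b| ≤ c) : rowNorm v ≤ c :=
  Real.iSup_le h hc

theorem rowNorm_zero : rowNorm (0 : EuclideanSpace ℝ (S × B)) = 0 := by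
  simp [rowNorm, row]

theorem row_mem_stdSimplex (p : Policy S B) (s : S) : row p.1 s ∈ stdSimplex ℝ B :=
  ⟨p.2.1 s, p.2.2 s⟩

theorem sum_abs_row_sub_le_two (p q : Policy S B) (s : S) : ∑ b, |row (p.1 - q.1) s b| ≤ 2 := by
  refine (Finset.sum_le_sum fun b _ => abs_sub (row p.1 s b) (row q.1 s b)).trans_eq ?_
  rw [Finset.sum_add_distrib, sum_abs_of_mem_stdSimplex (row_mem_stdSimplex p s),
    sum_abs_of_mem_stdSimplex (row_mem_stdSimplex q s)]
  norm_num

theorem rowNorm_policy_sub_le_two (p q : Policy S B) : rowNorm (p.1 - q.1) ≤ 2 :=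
  rowNorm_le zero_le_two (sum_abs_row_sub_le_two p q)

theorem sum_abs_row_le_rowNorm [Finite S] (v : EuclideanSpace ℝ (S × B)) (s : S) :
    ∑ b, |row v s b| ≤ rowNorm v :=
  le_ciSup (f := fun s => ∑ b, |row v s b|) (Set.finite_range _).bddAbove s

variable [Fintype S]

theorem norm_sq_eq_sum_row (v : EuclideanSpace ℝ (S × B)) :
    ‖v‖ ^ 2 = ∑ s, ∑ b, |row v s b| ^ 2 := by
  rw [EuclideanSpace.norm_sq_eq, Fintype.sum_prod_type]
  simp only [Real.norm_eq_abs, row]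

theorem rowNorm_le_sqrt_card_mul_norm (v : EuclideanSpace ℝ (S × B)) :
    rowNorm v ≤ √(Fintype.card B) * ‖v‖ := by
  refine rowNorm_le (by positivity) fun s => le_of_sq_le_sq ?_ (by positivity)
  have hcauchy : (∑ b, |row v s b|) ^ 2 ≤ Fintype.card B * ∑ b, |row v s b| ^ 2 := by
    simpa using sq_sum_le_card_mul_sum_sq (s := Finset.univ) (f := fun b => |row v s b|)
  have hrow : ∑ b, |row v s b| ^ 2 ≤ ‖v‖ ^ 2 := by
    rw [norm_sq_eq_sum_row]
    exact Finset.single_le_sum (f := fun s => ∑ b, |row v s b| ^ 2)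
      (fun s _ => Finset.sum_nonneg fun b _ => sq_nonneg _) (Finset.mem_univ s)
  rw [mul_pow, Real.sq_sqrt (by positivity)]
  exact hcauchy.trans (mul_le_mul_of_nonneg_left hrow (by positivity))

theorem norm_policy_sub_sq_le (p q : Policy S B) : ‖p.1 - q.1‖ ^ 2 ≤ 4 * Fintype.card S := by
  rw [norm_sq_eq_sum_row]
  have hrow : ∀ s, ∑ b, |row (p.1 - q.1) s b| ^ 2 ≤ 2 ^ 2 := fun s =>
    (Finset.sum_sq_le_sq_sum_of_nonneg fun b _ => abs_nonneg _).trans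
      (pow_le_pow_left₀ (Finset.sum_nonneg fun _ _ => abs_nonneg _)
        (sum_abs_row_sub_le_two p q s) 2)
  refine (Finset.sum_le_sum fun s _ => hrow s).trans_eq ?_
  norm_num [mul_comm]

end RowNorm

section Greedy

variable {S B : Type*} [Fintype B] [Nonempty B] {α : ℝ} (hα : α ∈ Set.Icc (0 : ℝ) 1)

theorem greedy_sub_greedy (p q : Policy S B) :
    (greedy α hα p).1 - (greedy α hα q).1 = (1 - α) • (p.1 - q.1) := by
  ext z
  simp only [greedy, PiLp.sub_apply, PiLp.smul_apply, smul_eq_mul]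
  ring

theorem norm_greedy_sub_greedy_le [Fintype S] (p q : Policy S B) :
    ‖(greedy α hα p).1 - (greedy α hα q).1‖ ≤ ‖p.1 - q.1‖ := by
  rw [greedy_sub_greedy, norm_smul, Real.norm_eq_abs, abs_of_nonneg (by linarith [hα.2])]
  exact mul_le_of_le_one_left (norm_nonneg _) (by linarith [hα.1])

theorem rowNorm_sub_greedy_le (p : Policy S B) : rowNorm (p.1 - (greedy α hα p).1) ≤ 2 * α := by
  refine rowNorm_le (mul_nonneg zero_le_two hα.1) fun s => ?_
  have hcard : (0 : ℝ) < Fintype.card B := Nat.cast_pos.2 Fintype.card_pos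
  have hentry : ∀ b, |row (p.1 - (greedy α hα p).1) s b| ≤
      α * row p.1 s b + α / Fintype.card B := fun b => by
    have hp := mul_nonneg hα.1 ((row_mem_stdSimplex p s).1 b)
    have hu := div_nonneg hα.1 hcard.le
    simp only [row, greedy, PiLp.sub_apply] at hp ⊢
    rw [abs_le]
    constructor <;> linarith
  refine (Finset.sum_le_sum fun b _ => hentry b).trans_eq ?_
  rw [Finset.sum_add_distrib, ← Finset.mul_sum, (row_mem_stdSimplex p s).2, Finset.sum_const,
    Finset.card_univ, nsmul_eq_mul, mul_div_cancel₀ _ hcard.ne']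
  ring

theorem div_card_le_greedy (p : Policy S B) (z : S × B) :
    α / Fintype.card B ≤ (greedy α hα p).1 z :=
  le_add_of_nonneg_left (mul_nonneg (by linarith [hα.2]) (p.2.1 z.1 z.2))

theorem greedy_pos (hα0 : 0 < α) (p : Policy S B) (z : S × B) : 0 < (greedy α hα p).1 z :=
  (div_pos hα0 (Nat.cast_pos.2 Fintype.card_pos)).trans_le (div_card_le_greedy hα p z)

/-- The joint policy made of the `α`-greedy policies with parameters `x`. -/
abbrev greedyProfile {N : Type*} {A : N → Type*} [∀ i, Fintype (A i)] [∀ i, Nonempty (A i)]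
    (x : JointPolicy N S A) : JointPolicy N S A :=
  fun i => greedy α hα (x i)

end Greedy

section JointPolicies

variable {N S : Type*} {A : N → Type*} [Fintype N] [∀ i, Fintype (A i)]

/-- The `ℓ¹` distance of two joint policies: summed over the agents, maximal over the states. -/
def policyDist (π π' : JointPolicy N S A) : ℝ := ∑ j, rowNorm ((π j).1 - (π' j).1)

theorem policyDist_nonneg (π π' : JointPolicy N S A) : 0 ≤ policyDist π π' :=
  Finset.sum_nonneg fun _ _ => rowNorm_nonneg _

variable [DecidableEq N]

theorem policyDist_piecewise_le (T : Finset N) (x y : JointPolicy N S A) :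
    policyDist (T.piecewise y x) x ≤ policyDist y x := by
  refine Finset.sum_le_sum fun j _ => ?_
  by_cases hj : j ∈ T
  · simp [hj]
  · simpa [hj, rowNorm_zero] using rowNorm_nonneg ((y j).1 - (x j).1)

theorem policyDist_update_update_self_le (π π' : JointPolicy N S A) (k : N) (p : Policy S (A k)) :
    policyDist (Function.update π k p) (Function.update π' k p) ≤ policyDist π π' := by
  refine Finset.sum_le_sum fun j _ => ?_
  by_cases hj : j = k
  · subst hj
    simpa [rowNorm_zero] using rowNorm_nonneg ((π j).1 - (π' j).1)
  · simp [Function.update_of_ne hj]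

theorem policyDist_update_update (π : JointPolicy N S A) (k : N) (p q : Policy S (A k)) :
    policyDist (Function.update π k p) (Function.update π k q) = rowNorm (p.1 - q.1) := by
  rw [policyDist, Finset.sum_eq_single k]
  · simp
  · intro j _ hj
    simp [Function.update_of_ne hj, rowNorm_zero]
  · simp

/-- The law of the action profile drawn at `s`, as a real vector. -/
def profileProb (π : JointPolicy N S A) (s : S) : (∀ i, A i) → ℝ :=
  prodWeight fun i => row (π i).1 s

theorem profileProb_mem_stdSimplex (π : JointPolicy N S A) (s : S) :
    profileProb π s ∈ stdSimplex ℝ (∀ i, A i) :=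
  prodWeight_mem_stdSimplex fun i => row_mem_stdSimplex (π i) s

theorem probVec_actionLaw (π : JointPolicy N S A) (s : S) :
    probVec (actionLaw π s) = profileProb π s := by
  funext a
  simp only [probVec, actionLaw, PMF.ofFintype_apply, profileProb, prodWeight,
    ENNReal.toReal_prod]
  exact Finset.prod_congr rfl fun i _ => ENNReal.toReal_ofReal ((π i).2.1 _ _)

/-- The signed profile weights at `s` when agent `k` uses the weights `v` in place of its policy;
the derivative of `profileProb π s` when the policy of agent `k` moves in direction `v`. -/
def deviationWeight (π : JointPolicy N S A) (k : N) (s : S) :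
    EuclideanSpace ℝ (S × A k) →ₗ[ℝ] ((∀ i, A i) → ℝ) where
  toFun v := prodWeight (Function.update (fun i => row (π i).1 s) k (row v s))
  map_add' v w := by
    funext a
    simp only [Pi.add_apply, prodWeight_update, row, PiLp.add_apply, add_mul]
  map_smul' c v := by
    funext a
    simp only [Pi.smul_apply, prodWeight_update, row, PiLp.smul_apply, smul_eq_mul, mul_assoc,
      RingHom.id_apply]

theorem profileProb_update (π : JointPolicy N S A) (k : N) (q : Policy S (A k)) (s : S) :
    profileProb (Function.update π k q) s = deviationWeight π k s q.1 := by
  rw [profileProb, deviationWeight, LinearMap.coe_mk, AddHom.coe_mk]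
  congr 1
  funext i
  by_cases hi : i = k
  · subst hi
    simp
  · simp [Function.update_of_ne hi]

theorem profileProb_eq_deviationWeight (π : JointPolicy N S A) (k : N) (s : S) :
    profileProb π s = deviationWeight π k s (π k).1 := by
  rw [← profileProb_update, Function.update_eq_self]

variable [Finite S]

theorem sum_abs_profileProb_sub_le (π π' : JointPolicy N S A) (s : S) :
    ∑ a, |profileProb π s a - profileProb π' s a| ≤ policyDist π π' := by
  have hrow : ∀ (π : JointPolicy N S A) (i : N), ∑ b, |row (π i).1 s b| ≤ 1 := fun π i =>
    (sum_abs_of_mem_stdSimplex (row_mem_stdSimplex (π i) s)).le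
  refine (sum_abs_prodWeight_sub_le (hrow π) (hrow π')).trans (Finset.sum_le_sum fun j _ => ?_)
  rw [Finset.prod_const_one, mul_one]
  exact sum_abs_row_le_rowNorm ((π j).1 - (π' j).1) s

theorem sum_abs_deviationWeight_le (π : JointPolicy N S A) (k : N) (s : S)
    (v : EuclideanSpace ℝ (S × A k)) : ∑ a, |deviationWeight π k s v a| ≤ rowNorm v := by
  refine (sum_abs_prodWeight_update _ k _).trans_le ?_
  rw [Finset.prod_eq_one fun i _ => sum_abs_of_mem_stdSimplex (row_mem_stdSimplex (π i) s),
    mul_one]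
  exact sum_abs_row_le_rowNorm v s

theorem sum_abs_deviationWeight_sub_le (π π' : JointPolicy N S A) (k : N) (s : S)
    (v : EuclideanSpace ℝ (S × A k)) :
    ∑ a, |deviationWeight π k s v a - deviationWeight π' k s v a| ≤
      rowNorm v * policyDist π π' := by
  set c : N → ℝ := Function.update (fun _ => 1) k (∑ b, |row v s b|) with hc
  have hrow : ∀ (π : JointPolicy N S A) (i : N),
      ∑ b, |Function.update (fun i => row (π i).1 s) k (row v s) i b| ≤ c i := fun π i => by
    by_cases hi : i = k
    · subst hi
      simp [hc]
    · simp [hc, hi, sum_abs_of_mem_stdSimplex (row_mem_stdSimplex (π i) s)]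
  refine (sum_abs_prodWeight_sub_le (hrow π) (hrow π')).trans ?_
  rw [policyDist, Finset.mul_sum]
  refine Finset.sum_le_sum fun j _ => ?_
  by_cases hj : j = k
  · subst hj
    simpa using mul_nonneg (rowNorm_nonneg v) (rowNorm_nonneg ((π j).1 - (π' j).1))
  · have hprod : ∏ i ∈ Finset.univ.erase j, c i = ∑ b, |row v s b| := by
      rw [hc, Finset.prod_update_of_mem (by simpa using Ne.symm hj), Finset.prod_const_one,
        mul_one]
    rw [hprod, mul_comm, Function.update_of_ne hj, Function.update_of_ne hj]
    exact mul_le_mul (sum_abs_row_le_rowNorm v s)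
      (sum_abs_row_le_rowNorm ((π j).1 - (π' j).1) s)
      (Finset.sum_nonneg fun _ _ => abs_nonneg _) (rowNorm_nonneg v)

end JointPolicies

namespace Game

section Dynamics

variable {N S : Type*} {A : N → Type*} (G : Game N S A)

theorem one_sub_discount_pos : 0 < 1 - G.discount := sub_pos.2 G.discount_lt_one

include G in
theorem one_le_card_state [Fintype S] : 1 ≤ Fintype.card S :=
  have ⟨s, _⟩ := G.init.support_nonempty
  Fintype.card_pos_iff.2 ⟨s⟩

/-- The expectation of `u` at the next state, as a function of the action profile played at `s`. -/
def expectNext [Fintype S] (u : S → ℝ) (s : S) (a : ∀ i, A i) : ℝ :=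
  probVec (G.trans s a) ⬝ᵥ u

theorem abs_expectNext_le [Fintype S] {u : S → ℝ} {M : ℝ} (hu : ∀ s, |u s| ≤ M) (s : S)
    (a : ∀ i, A i) : |G.expectNext u s a| ≤ M :=
  abs_dotProduct_le_of_mem_stdSimplex (probVec_mem_stdSimplex _) hu

variable [Fintype N] [DecidableEq N] [∀ i, Fintype (A i)]

/-- The transition matrix of the state process when `π` is played. -/
def transitionMatrix (π : JointPolicy N S A) : Matrix S S ℝ :=
  fun s => probVec ((actionLaw π s).bind (G.trans s))

theorem summable_visitation (π : JointPolicy N S A) (ν : PMF S) (s : S) :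
    Summable fun t : ℕ => G.discount ^ t * (G.stateLaw π ν t s).toReal :=
  Summable.of_nonneg_of_le
    (fun t => mul_nonneg (pow_nonneg G.discount_nonneg t) ENNReal.toReal_nonneg)
    (fun t => mul_le_of_le_one_right (pow_nonneg G.discount_nonneg t)
      (ENNReal.toReal_mono ENNReal.one_ne_top (PMF.coe_le_one _ s)))
    (summable_geometric_of_lt_one G.discount_nonneg G.discount_lt_one)

theorem le_visitation (π : JointPolicy N S A) (ν : PMF S) (s : S) :
    (1 - G.discount) * (ν s).toReal ≤ G.visitation π ν s := by
  refine mul_le_mul_of_nonneg_left ?_ G.one_sub_discount_pos.le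
  simpa [stateLaw] using (G.summable_visitation π ν s).le_tsum 0 fun t _ =>
    mul_nonneg (pow_nonneg G.discount_nonneg t) ENNReal.toReal_nonneg

variable [Fintype S]

theorem transitionMatrix_mulVec (π : JointPolicy N S A) (u : S → ℝ) (s : S) :
    (G.transitionMatrix π *ᵥ u) s = profileProb π s ⬝ᵥ G.expectNext u s := by
  simp only [← probVec_actionLaw, Matrix.mulVec, transitionMatrix, dotProduct, expectNext,
    probVec_bind, Finset.sum_mul, Finset.mul_sum]
  rw [Finset.sum_comm]
  simp only [mul_assoc]

theorem probVec_stateLaw_succ (π : JointPolicy N S A) (ν : PMF S) (t : ℕ) :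
    probVec (G.stateLaw π ν (t + 1)) =
      probVec (G.stateLaw π ν t) ᵥ* G.transitionMatrix π :=
  funext fun _ => probVec_bind _ _ _

theorem hasSum_visitation (π : JointPolicy N S A) (ν : PMF S) (u : S → ℝ) :
    HasSum (fun t : ℕ => G.discount ^ t * probVec (G.stateLaw π ν t) ⬝ᵥ u)
      ((1 - G.discount)⁻¹ * G.visitation π ν ⬝ᵥ u) := by
  have h : HasSum (fun t : ℕ => ∑ s, G.discount ^ t * (G.stateLaw π ν t s).toReal * u s)
      (∑ s, (∑' t : ℕ, G.discount ^ t * (G.stateLaw π ν t s).toReal) * u s) :=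
    hasSum_sum fun s _ => (G.summable_visitation π ν s).hasSum.mul_right (u s)
  convert h using 1
  · simp only [dotProduct, probVec, Finset.mul_sum, mul_assoc]
  · simp only [dotProduct, visitation, Finset.mul_sum, mul_assoc,
      inv_mul_cancel_left₀ G.one_sub_discount_pos.ne']

theorem visitation_dotProduct_sub (π : JointPolicy N S A) (ν : PMF S) (u : S → ℝ) :
    G.visitation π ν ⬝ᵥ (u - G.discount • (G.transitionMatrix π *ᵥ u)) =
      (1 - G.discount) * probVec ν ⬝ᵥ u := by
  have htail := (hasSum_nat_add_iff' 1).2 (G.hasSum_visitation π ν u)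
  have hshift : (fun t : ℕ => G.discount ^ (t + 1) * probVec (G.stateLaw π ν (t + 1)) ⬝ᵥ u) =
      fun t : ℕ => G.discount *
        (G.discount ^ t * probVec (G.stateLaw π ν t) ⬝ᵥ (G.transitionMatrix π *ᵥ u)) := by
    funext t
    rw [probVec_stateLaw_succ, ← Matrix.dotProduct_mulVec, pow_succ']
    ring
  rw [hshift] at htail
  have heq := htail.unique
    ((G.hasSum_visitation π ν (G.transitionMatrix π *ᵥ u)).mul_left G.discount)
  simp only [Finset.range_one, Finset.sum_singleton, pow_zero, one_mul, stateLaw] at heq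
  have hne := G.one_sub_discount_pos.ne'
  rw [dotProduct_sub, dotProduct_smul, smul_eq_mul]
  field_simp at heq
  linarith

theorem visitation_mem_stdSimplex (π : JointPolicy N S A) (ν : PMF S) :
    G.visitation π ν ∈ stdSimplex ℝ S := by
  refine ⟨fun s => (mul_nonneg G.one_sub_discount_pos.le ENNReal.toReal_nonneg).trans
    (G.le_visitation π ν s), ?_⟩
  have hconst : (fun _ : S => (1 : ℝ)) - G.discount • (G.transitionMatrix π *ᵥ fun _ => 1) =
      fun _ => 1 - G.discount := by
    funext s
    simp only [Pi.sub_apply, Pi.smul_apply, smul_eq_mul, Matrix.mulVec, transitionMatrix,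
      dotProduct_const_of_mem_stdSimplex (probVec_mem_stdSimplex _), mul_one]
  have h := G.visitation_dotProduct_sub π ν fun _ => 1
  rw [hconst, dotProduct_const_of_mem_stdSimplex (probVec_mem_stdSimplex ν), dotProduct,
    ← Finset.sum_mul, mul_comm] at h
  exact mul_left_cancel₀ G.one_sub_discount_pos.ne' h

theorem visitation_pure_dotProduct {π : JointPolicy N S A} {f u : S → ℝ}
    (hu : u - G.discount • (G.transitionMatrix π *ᵥ u) = f) (s : S) :
    G.visitation π (PMF.pure s) ⬝ᵥ f = (1 - G.discount) * u s := by
  rw [← hu, visitation_dotProduct_sub, probVec_pure_dotProduct]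

theorem bellman_unique {π : JointPolicy N S A} {f u v : S → ℝ}
    (hu : u - G.discount • (G.transitionMatrix π *ᵥ u) = f)
    (hv : v - G.discount • (G.transitionMatrix π *ᵥ v) = f) : u = v :=
  funext fun s => mul_left_cancel₀ G.one_sub_discount_pos.ne'
    ((G.visitation_pure_dotProduct hu s).symm.trans (G.visitation_pure_dotProduct hv s))

theorem exists_bellman (π : JointPolicy N S A) (f : S → ℝ) :
    ∃ u : S → ℝ, u - G.discount • (G.transitionMatrix π *ᵥ u) = f := by
  let L : (S → ℝ) →ₗ[ℝ] (S → ℝ) :=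
    LinearMap.id - G.discount • (G.transitionMatrix π).mulVecLin
  have hinj : Function.Injective L := fun _ _ huv => G.bellman_unique huv rfl
  exact LinearMap.injective_iff_surjective.1 hinj f

theorem abs_le_of_bellman {π : JointPolicy N S A} {f u : S → ℝ} {M : ℝ} (hf : ∀ s, |f s| ≤ M)
    (hu : u - G.discount • (G.transitionMatrix π *ᵥ u) = f) (s : S) :
    |u s| ≤ M / (1 - G.discount) := by
  have h := abs_dotProduct_le_of_mem_stdSimplex
    (G.visitation_mem_stdSimplex π (PMF.pure s)) hf
  rwa [G.visitation_pure_dotProduct hu, abs_mul, abs_of_pos G.one_sub_discount_pos,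
    ← le_div_iff₀' G.one_sub_discount_pos] at h

theorem abs_visitation_dotProduct_sub_le (ν : PMF S) (π π' : JointPolicy N S A) {f : S → ℝ}
    {M : ℝ} (hM : 0 ≤ M) (hf : ∀ s, |f s| ≤ M) :
    |G.visitation π ν ⬝ᵥ f - G.visitation π' ν ⬝ᵥ f| ≤
      G.discount * policyDist π π' * M / (1 - G.discount) := by
  have hp := G.one_sub_discount_pos
  obtain ⟨u, hu⟩ := G.exists_bellman π' f
  have hdiff : G.visitation π ν ⬝ᵥ f - G.visitation π' ν ⬝ᵥ f = G.visitation π ν ⬝ᵥ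
      fun s => G.discount * (profileProb π s - profileProb π' s) ⬝ᵥ G.expectNext u s := by
    nth_rw 2 [← hu]
    rw [visitation_dotProduct_sub, ← G.visitation_dotProduct_sub π, ← dotProduct_sub, ← hu]
    congr 1
    funext s
    simp only [Pi.sub_apply, Pi.smul_apply, smul_eq_mul, transitionMatrix_mulVec,
      sub_dotProduct]
    ring
  rw [hdiff]
  refine abs_dotProduct_le_of_mem_stdSimplex (G.visitation_mem_stdSimplex π ν) fun s => ?_
  rw [abs_mul, abs_of_nonneg G.discount_nonneg, mul_assoc, mul_div_assoc, mul_div_assoc]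
  refine mul_le_mul_of_nonneg_left ?_ G.discount_nonneg
  exact (abs_dotProduct_le _ (G.abs_expectNext_le (G.abs_le_of_bellman hf hu) s)).trans
    (mul_le_mul_of_nonneg_right (sum_abs_profileProb_sub_le π π' s) (div_nonneg hM hp.le))

end Dynamics

section Values

variable {N S : Type*} {A : N → Type*} [Fintype N] [DecidableEq N] [Fintype S]
  [∀ i, Fintype (A i)] (G : Game N S A)

/-- The expected instantaneous reward of agent `i` at each state. -/
def meanReward (i : N) (π : JointPolicy N S A) (s : S) : ℝ :=
  profileProb π s ⬝ᵥ G.reward i s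

/-- The values `V_s^i(π)` of agent `i`, as a vector indexed by the state. -/
def valueVec (i : N) (π : JointPolicy N S A) (s : S) : ℝ := G.stateValue i s π

theorem value_eq_dotProduct (i : N) (ν : PMF S) (π : JointPolicy N S A) :
    G.value i ν π = probVec ν ⬝ᵥ G.valueVec i π :=
  rfl

theorem stateValue_eq_visitation (i : N) (π : JointPolicy N S A) (s : S) :
    G.stateValue i s π =
      (1 - G.discount)⁻¹ * G.visitation π (PMF.pure s) ⬝ᵥ G.meanReward i π := by
  rw [← (G.hasSum_visitation π (PMF.pure s) (G.meanReward i π)).tsum_eq, stateValue]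
  simp only [expReward, dotProduct, meanReward, ← probVec_actionLaw, probVec]

theorem valueVec_bellman (i : N) (π : JointPolicy N S A) :
    G.valueVec i π - G.discount • (G.transitionMatrix π *ᵥ G.valueVec i π) =
      G.meanReward i π := by
  obtain ⟨u, hu⟩ := G.exists_bellman π (G.meanReward i π)
  have hvalue : G.valueVec i π = u := funext fun s => by
    rw [valueVec, stateValue_eq_visitation, G.visitation_pure_dotProduct hu,
      inv_mul_cancel_left₀ G.one_sub_discount_pos.ne']
  rw [hvalue, hu]

theorem abs_valueVec_le (i : N) (π : JointPolicy N S A) (s : S) :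
    |G.valueVec i π s| ≤ 1 / (1 - G.discount) :=
  G.abs_le_of_bellman (fun s => abs_dotProduct_le_of_mem_stdSimplex
    (profileProb_mem_stdSimplex π s) (G.abs_reward_le i s)) (G.valueVec_bellman i π) s

/-- The action values of agent `i` at `s`: the expected discounted reward when a given action
profile is played once and `π` afterwards. -/
def actionValue (i : N) (π : JointPolicy N S A) (s : S) : (∀ i, A i) → ℝ :=
  G.reward i s + G.discount • G.expectNext (G.valueVec i π) s

theorem abs_actionValue_le (i : N) (π : JointPolicy N S A) (s : S) (a : ∀ i, A i) :
    |G.actionValue i π s a| ≤ 1 / (1 - G.discount) := by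
  have hnext := mul_le_mul_of_nonneg_left
    (G.abs_expectNext_le (G.abs_valueVec_le i π) s a) G.discount_nonneg
  have hsum : 1 + G.discount * (1 / (1 - G.discount)) = 1 / (1 - G.discount) := by
    have := G.one_sub_discount_pos.ne'
    field_simp
    ring
  refine (abs_add_le _ _).trans ?_
  rw [Pi.smul_apply, smul_eq_mul, abs_mul, abs_of_nonneg G.discount_nonneg]
  linarith [G.abs_reward_le i s a]

theorem profileProb_dotProduct_actionValue (i : N) (π π' : JointPolicy N S A) (s : S) :
    profileProb π' s ⬝ᵥ G.actionValue i π s =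
      G.meanReward i π' s + G.discount * (G.transitionMatrix π' *ᵥ G.valueVec i π) s := by
  rw [actionValue, dotProduct_add, dotProduct_smul, transitionMatrix_mulVec, smul_eq_mul,
    meanReward]

theorem profileProb_dotProduct_actionValue_self (i : N) (π : JointPolicy N S A) (s : S) :
    profileProb π s ⬝ᵥ G.actionValue i π s = G.valueVec i π s := by
  rw [profileProb_dotProduct_actionValue, ← G.valueVec_bellman i π]
  simp

theorem performance_difference (i : N) (ν : PMF S) (π π' : JointPolicy N S A) :
    (1 - G.discount) * (G.value i ν π' - G.value i ν π) = G.visitation π' ν ⬝ᵥ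
      fun s => (profileProb π' s - profileProb π s) ⬝ᵥ G.actionValue i π s := by
  rw [value_eq_dotProduct, value_eq_dotProduct, ← dotProduct_sub, ← G.visitation_dotProduct_sub π']
  congr 1
  funext s
  have hbellman := congrFun (G.valueVec_bellman i π') s
  rw [sub_dotProduct, profileProb_dotProduct_actionValue,
    profileProb_dotProduct_actionValue_self, ← hbellman, Matrix.mulVec_sub]
  simp only [Pi.sub_apply, Pi.smul_apply, smul_eq_mul]
  ring

theorem abs_value_sub_le (i : N) (ν : PMF S) (π π' : JointPolicy N S A) :
    |G.value i ν π - G.value i ν π'| ≤ policyDist π π' / (1 - G.discount) ^ 2 := by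
  have hp := G.one_sub_discount_pos
  have h := abs_dotProduct_le_of_mem_stdSimplex (G.visitation_mem_stdSimplex π ν) fun s =>
    (abs_dotProduct_le (profileProb π s - profileProb π' s) (G.abs_actionValue_le i π' s)).trans
      (mul_le_mul_of_nonneg_right (sum_abs_profileProb_sub_le π π' s) (one_div_pos.2 hp).le)
  rw [← performance_difference, abs_mul, abs_of_pos hp, ← le_div_iff₀' hp] at h
  rwa [mul_one_div, div_div, ← sq] at h

theorem abs_actionValue_sub_le (i : N) (π π' : JointPolicy N S A) (s : S) (a : ∀ i, A i) :
    |G.actionValue i π s a - G.actionValue i π' s a| ≤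
      G.discount * (policyDist π π' / (1 - G.discount) ^ 2) := by
  have hstate : ∀ s, |(G.valueVec i π - G.valueVec i π') s| ≤
      policyDist π π' / (1 - G.discount) ^ 2 := fun s => by
    have h := G.abs_value_sub_le i (PMF.pure s) π π'
    rwa [value_eq_dotProduct, value_eq_dotProduct, probVec_pure_dotProduct,
      probVec_pure_dotProduct] at h
  have hdiff : G.actionValue i π s a - G.actionValue i π' s a =
      G.discount * G.expectNext (G.valueVec i π - G.valueVec i π') s a := by
    simp only [actionValue, expectNext, Pi.add_apply, Pi.smul_apply, smul_eq_mul, dotProduct_sub]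
    ring
  rw [hdiff, abs_mul, abs_of_nonneg G.discount_nonneg]
  exact mul_le_mul_of_nonneg_left (G.abs_expectNext_le hstate s a) G.discount_nonneg

end Values

end Game

namespace Game

section PolicyGradient

variable {N S : Type*} {A : N → Type*} [Fintype N] [DecidableEq N] [Fintype S]
  [∀ i, Fintype (A i)] (G : Game N S A)

/-- The expected action value of agent `k` at each state under the weights `deviationWeight`: the
advantage of the deviation of agent `k` in direction `v`. -/
def deviationAdvantage (k : N) (π : JointPolicy N S A) :
    EuclideanSpace ℝ (S × A k) →ₗ[ℝ] (S → ℝ) where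
  toFun v s := deviationWeight π k s v ⬝ᵥ G.actionValue k π s
  map_add' v w := funext fun s => by rw [map_add, add_dotProduct]; rfl
  map_smul' c v := funext fun s => by rw [map_smul, smul_dotProduct]; rfl

/-- The derivative of the value of agent `k` at the initial distribution with respect to its own
policy, as given by the policy gradient theorem. -/
def policyGradient (k : N) (π : JointPolicy N S A) :
    EuclideanSpace ℝ (S × A k) →ₗ[ℝ] ℝ where
  toFun v := (1 - G.discount)⁻¹ * G.visitation π G.init ⬝ᵥ G.deviationAdvantage k π v
  map_add' v w := by rw [map_add, dotProduct_add, mul_add]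
  map_smul' c v := by
    rw [map_smul, dotProduct_smul, smul_eq_mul, mul_left_comm, RingHom.id_apply, smul_eq_mul]

theorem policyGradient_apply (k : N) (π : JointPolicy N S A) (v : EuclideanSpace ℝ (S × A k)) :
    G.policyGradient k π v =
      (1 - G.discount)⁻¹ * G.visitation π G.init ⬝ᵥ G.deviationAdvantage k π v :=
  rfl

theorem value_update_sub (k : N) (ν : PMF S) (π : JointPolicy N S A) (q : Policy S (A k)) :
    (1 - G.discount) * (G.value k ν (Function.update π k q) - G.value k ν π) =
      G.visitation (Function.update π k q) ν ⬝ᵥ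
        G.deviationAdvantage k π (q.1 - (π k).1) := by
  rw [performance_difference]
  congr 1
  funext s
  rw [profileProb_update, profileProb_eq_deviationWeight π k, ← map_sub]
  rfl

theorem abs_deviationAdvantage_le (k : N) (π : JointPolicy N S A)
    (v : EuclideanSpace ℝ (S × A k)) (s : S) :
    |G.deviationAdvantage k π v s| ≤ rowNorm v / (1 - G.discount) := by
  have h := (abs_dotProduct_le _ (G.abs_actionValue_le k π s)).trans
    (mul_le_mul_of_nonneg_right (sum_abs_deviationWeight_le π k s v)
      (one_div_pos.2 G.one_sub_discount_pos).le)
  rwa [mul_one_div] at h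

theorem abs_policyGradient_le (k : N) (π : JointPolicy N S A) (v : EuclideanSpace ℝ (S × A k)) :
    |G.policyGradient k π v| ≤ rowNorm v / (1 - G.discount) ^ 2 := by
  have hp := G.one_sub_discount_pos
  rw [policyGradient_apply, abs_mul, abs_of_pos (inv_pos.2 hp), inv_mul_le_iff₀ hp]
  refine (abs_dotProduct_le_of_mem_stdSimplex (G.visitation_mem_stdSimplex π G.init)
    (G.abs_deviationAdvantage_le k π v)).trans_eq ?_
  field_simp

theorem abs_deviationAdvantage_sub_le (k : N) (π π' : JointPolicy N S A)
    (v : EuclideanSpace ℝ (S × A k)) (s : S) :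
    |(G.deviationAdvantage k π v - G.deviationAdvantage k π' v) s| ≤
      rowNorm v * policyDist π π' / (1 - G.discount) ^ 2 := by
  have hp := G.one_sub_discount_pos
  have hγ := G.discount_nonneg
  have hdist := policyDist_nonneg π π'
  have hsplit : (G.deviationAdvantage k π v - G.deviationAdvantage k π' v) s =
      deviationWeight π k s v ⬝ᵥ (G.actionValue k π s - G.actionValue k π' s) +
        (deviationWeight π k s v - deviationWeight π' k s v) ⬝ᵥ G.actionValue k π' s := by
    simp only [deviationAdvantage, LinearMap.coe_mk, AddHom.coe_mk, Pi.sub_apply,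
      dotProduct_sub, sub_dotProduct]
    ring
  have hvalues := (abs_dotProduct_le (deviationWeight π k s v)
    (G.abs_actionValue_sub_le k π π' s)).trans
      (mul_le_mul_of_nonneg_right (sum_abs_deviationWeight_le π k s v) (by positivity))
  have hweights := (abs_dotProduct_le (deviationWeight π k s v - deviationWeight π' k s v)
    (G.abs_actionValue_le k π' s)).trans
      (mul_le_mul_of_nonneg_right (sum_abs_deviationWeight_sub_le π π' k s v) (by positivity))
  rw [hsplit]
  refine ((abs_add_le _ _).trans (add_le_add hvalues hweights)).trans_eq ?_
  field_simp
  ring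

theorem abs_value_update_sub_sub_policyGradient_le (k : N) {x z : JointPolicy N S A}
    (hk : z k = x k) (q : Policy S (A k)) {E : ℝ} (hz : policyDist z x ≤ E)
    (hq : policyDist (Function.update z k q) x ≤ E) :
    |G.value k G.init (Function.update z k q) - G.value k G.init z -
      G.policyGradient k x (q.1 - (x k).1)| ≤
        2 * rowNorm (q.1 - (x k).1) * E / (1 - G.discount) ^ 3 := by
  have hp := G.one_sub_discount_pos
  have hγ := G.discount_nonneg
  set v := q.1 - (x k).1
  have hv : 0 ≤ rowNorm v := rowNorm_nonneg v
  have hE : 0 ≤ E := (policyDist_nonneg z x).trans hz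
  have hsplit : (1 - G.discount) * (G.value k G.init (Function.update z k q) -
      G.value k G.init z - G.policyGradient k x v) =
      (G.visitation (Function.update z k q) G.init ⬝ᵥ G.deviationAdvantage k z v -
        G.visitation x G.init ⬝ᵥ G.deviationAdvantage k z v) +
      G.visitation x G.init ⬝ᵥ (G.deviationAdvantage k z v - G.deviationAdvantage k x v) := by
    rw [mul_sub, value_update_sub, hk, policyGradient_apply, mul_inv_cancel_left₀ hp.ne',
      dotProduct_sub]
    ring
  have hvisit := G.abs_visitation_dotProduct_sub_le G.init (Function.update z k q) x
    (div_nonneg hv hp.le) (G.abs_deviationAdvantage_le k z v)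
  have hadv := abs_dotProduct_le_of_mem_stdSimplex (G.visitation_mem_stdSimplex x G.init)
    (G.abs_deviationAdvantage_sub_le k z x v)
  have hbound : (1 - G.discount) * |G.value k G.init (Function.update z k q) -
      G.value k G.init z - G.policyGradient k x v| ≤
      G.discount * E * (rowNorm v / (1 - G.discount)) / (1 - G.discount) +
        rowNorm v * E / (1 - G.discount) ^ 2 := by
    rw [← abs_of_pos hp, ← abs_mul, abs_of_pos hp, hsplit]
    refine (abs_add_le _ _).trans (add_le_add (hvisit.trans ?_) (hadv.trans ?_)) <;> gcongr
  have hcollect : G.discount * E * (rowNorm v / (1 - G.discount)) / (1 - G.discount) +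
      rowNorm v * E / (1 - G.discount) ^ 2 =
      (1 + G.discount) * rowNorm v * E / (1 - G.discount) ^ 2 := by
    field_simp
    ring
  rw [hcollect, ← le_div_iff₀' hp, div_div, ← pow_succ] at hbound
  refine hbound.trans ?_
  have hγ1 : 1 + G.discount ≤ 2 := by linarith [G.discount_lt_one]
  gcongr

theorem exists_deviationAdvantage_sub_eq_max (k : N) (π : JointPolicy N S A)
    (p q : Policy S (A k)) :
    ∃ y : Policy S (A k), ∀ s, G.deviationAdvantage k π (y.1 - p.1) s =
      max (G.deviationAdvantage k π (q.1 - p.1) s) 0 := by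
  classical
  let switch : S → Policy S (A k) := fun s =>
    if 0 ≤ G.deviationAdvantage k π (q.1 - p.1) s then q else p
  let y : Policy S (A k) := ⟨WithLp.toLp 2 fun z => (switch z.1).1 z,
    fun s => (row_mem_stdSimplex (switch s) s).1, fun s => (row_mem_stdSimplex (switch s) s).2⟩
  refine ⟨y, fun s => ?_⟩
  have hrow : ∀ u v : EuclideanSpace ℝ (S × A k), row u s = row v s →
      G.deviationAdvantage k π u s = G.deviationAdvantage k π v s := fun u v huv => by
    simp only [deviationAdvantage, deviationWeight, LinearMap.coe_mk, AddHom.coe_mk, huv]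
  rw [hrow (y.1 - p.1) ((switch s).1 - p.1) rfl]
  by_cases hs : 0 ≤ G.deviationAdvantage k π (q.1 - p.1) s
  · simp only [switch, if_pos hs, max_eq_left hs]
  · simp only [switch, if_neg hs, max_eq_right (not_le.1 hs).le, sub_self, map_zero,
      Pi.zero_apply]

end PolicyGradient

section Potential

variable {N S : Type*} {A : N → Type*} [Fintype S] (G : Game N S A)

/-- The potential `Φ_ρ` averaged over the law `ρ` of the initial state. -/
def meanPotential [∀ i, Fintype (A i)] (Φ : S → JointPolicy N S A → ℝ)
    (π : JointPolicy N S A) : ℝ :=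
  probVec G.init ⬝ᵥ fun s => Φ s π

variable [Fintype N] [DecidableEq N] [∀ i, Fintype (A i)] {G}
  {Φ : S → JointPolicy N S A → ℝ} (hΦ : G.IsPotential Φ)
include hΦ

theorem IsPotential.meanPotential_update_sub (k : N) (π : JointPolicy N S A)
    (q : Policy S (A k)) :
    G.meanPotential Φ (Function.update π k q) - G.meanPotential Φ π =
      G.value k G.init (Function.update π k q) - G.value k G.init π := by
  simp only [meanPotential, value_eq_dotProduct, ← dotProduct_sub]
  congr 1
  funext s
  simpa [valueVec] using hΦ k s π q (π k)

theorem IsPotential.abs_meanPotential_sub_sub_le (x y : JointPolicy N S A) :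
    |G.meanPotential Φ y - G.meanPotential Φ x -
      ∑ k, G.policyGradient k x ((y k).1 - (x k).1)| ≤
        2 * policyDist y x ^ 2 / (1 - G.discount) ^ 3 := by
  suffices key : ∀ T : Finset N, |G.meanPotential Φ (T.piecewise y x) - G.meanPotential Φ x -
      ∑ k ∈ T, G.policyGradient k x ((y k).1 - (x k).1)| ≤
        ∑ k ∈ T, 2 * rowNorm ((y k).1 - (x k).1) * policyDist y x / (1 - G.discount) ^ 3 by
    have h := key Finset.univ
    rw [Finset.piecewise_univ, ← Finset.sum_div, ← Finset.sum_mul, ← Finset.mul_sum] at h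
    refine h.trans_eq ?_
    rw [← policyDist]
    ring
  intro T
  induction T using Finset.induction_on with
  | empty => simp
  | insert k T hk ih =>
    have hstep := G.abs_value_update_sub_sub_policyGradient_le k
      (Finset.piecewise_eq_of_notMem T y x hk) (y k) (policyDist_piecewise_le T x y)
      (by rw [← Finset.piecewise_insert]; exact policyDist_piecewise_le _ x y)
    rw [← hΦ.meanPotential_update_sub, ← Finset.piecewise_insert] at hstep
    rw [Finset.sum_insert hk, Finset.sum_insert hk]
    refine le_trans (le_of_eq ?_) ((abs_add_le _ _).trans (add_le_add hstep ih))
    congr 1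
    ring

theorem IsPotential.abs_meanPotential_sub_le (x y : JointPolicy N S A) :
    |G.meanPotential Φ y - G.meanPotential Φ x| ≤
      policyDist y x / (1 - G.discount) ^ 2 +
        2 * policyDist y x ^ 2 / (1 - G.discount) ^ 3 := by
  have hlinear : |∑ k, G.policyGradient k x ((y k).1 - (x k).1)| ≤
      policyDist y x / (1 - G.discount) ^ 2 := by
    rw [policyDist, Finset.sum_div]
    exact (Finset.abs_sum_le_sum_abs _ _).trans
      (Finset.sum_le_sum fun k _ => G.abs_policyGradient_le k x _)
  have hquad := hΦ.abs_meanPotential_sub_sub_le x y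
  rw [abs_le] at *
  constructor <;> linarith [hlinear.1, hlinear.2, hquad.1, hquad.2]

theorem IsPotential.meanPotential_sub_le_potentialRange (x y : JointPolicy N S A) :
    G.meanPotential Φ x - G.meanPotential Φ y ≤ G.potentialRange Φ := by
  have hp := G.one_sub_discount_pos
  refine le_ciSup (f := fun z : JointPolicy N S A × JointPolicy N S A =>
    G.meanPotential Φ z.1 - G.meanPotential Φ z.2) ?_ (x, y)
  refine ⟨(∑ _j : N, 2) / (1 - G.discount) ^ 2 +
    2 * (∑ _j : N, 2) ^ 2 / (1 - G.discount) ^ 3, ?_⟩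
  rintro _ ⟨z, rfl⟩
  have hdist : policyDist z.1 z.2 ≤ ∑ _j : N, 2 :=
    Finset.sum_le_sum fun j _ => rowNorm_policy_sub_le_two _ _
  have hnonneg := policyDist_nonneg z.1 z.2
  refine (le_abs_self _).trans ((hΦ.abs_meanPotential_sub_le z.2 z.1).trans ?_)
  gcongr

theorem IsPotential.potentialRange_nonneg (π : JointPolicy N S A) : 0 ≤ G.potentialRange Φ :=
  (sub_self _).symm.trans_le (hΦ.meanPotential_sub_le_potentialRange π π)

end Potential

section GradientDomination

variable {N S : Type*} {A : N → Type*} [Fintype N] [DecidableEq N]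
  [∀ i, Fintype (A i)] {G : Game N S A} {I : Set (PMF S)}

variable (hI : ∀ ν ∈ I, ∀ (π : JointPolicy N S A) (s : S),
  G.init s = 0 → G.visitation π ν s = 0)
include hI

theorem visitation_le_mismatch_mul [Finite S] {ν : PMF S} (hν : ν ∈ I)
    (π : JointPolicy N S A) (s : S) :
    G.visitation π ν s ≤ G.mismatch I * (G.init s).toReal := by
  have := Fintype.ofFinite S
  by_cases h0 : G.init s = 0
  · simp [hI ν hν π s h0, h0]
  rw [← div_le_iff₀ (ENNReal.toReal_pos h0 (G.init.apply_ne_top s))]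
  refine le_ciSup (f := fun z : I × JointPolicy N S A × S =>
    G.visitation z.2.1 z.1.1 z.2.2 / (G.init z.2.2).toReal) ?_ (⟨ν, hν⟩, π, s)
  refine ⟨∑ s, 1 / (G.init s).toReal, ?_⟩
  rintro _ ⟨z, rfl⟩
  refine le_trans ?_ (Finset.single_le_sum (f := fun s => 1 / (G.init s).toReal)
    (fun s _ => by positivity) (Finset.mem_univ z.2.2))
  have hvisit := G.visitation_mem_stdSimplex z.2.1 z.1.1
  refine div_le_div_of_nonneg_right ?_ ENNReal.toReal_nonneg
  rw [← hvisit.2]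
  exact Finset.single_le_sum (fun s _ => hvisit.1 s) (Finset.mem_univ z.2.2)

theorem one_le_mismatch [Finite S] [∀ i, Nonempty (A i)] (hne : I.Nonempty) : 1 ≤ G.mismatch I := by
  have := Fintype.ofFinite S
  obtain ⟨ν, hν⟩ := hne
  let π : JointPolicy N S A := fun i => ⟨_, (policySet_nonempty S (A i)).some_mem⟩
  have h := Finset.sum_le_sum fun s (_ : s ∈ Finset.univ) =>
    visitation_le_mismatch_mul hI hν π s
  have hinit : ∑ s, (G.init s).toReal = 1 := (probVec_mem_stdSimplex G.init).2
  rwa [(G.visitation_mem_stdSimplex π ν).2, ← Finset.mul_sum, hinit, mul_one] at h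

variable [Fintype S]

theorem value_update_sub_le [∀ i, Nonempty (A i)] {ν : PMF S} (hν : ν ∈ I) (k : N)
    (π : JointPolicy N S A) (q : Policy S (A k)) :
    G.value k ν (Function.update π k q) - G.value k ν π ≤ G.mismatch I / (1 - G.discount) *
      ((1 - G.discount)⁻¹ * G.visitation π G.init ⬝ᵥ
        fun s => max (G.deviationAdvantage k π (q.1 - (π k).1) s) 0) := by
  have hp := G.one_sub_discount_pos
  have hD := zero_le_one.trans (one_le_mismatch hI ⟨ν, hν⟩)
  set gain : S → ℝ := fun s => max (G.deviationAdvantage k π (q.1 - (π k).1) s) 0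
  have hgain : 0 ≤ gain := fun s => le_max_right _ _
  have hmismatch : (1 - G.discount) * (G.value k ν (Function.update π k q) - G.value k ν π) ≤
      G.mismatch I * probVec G.init ⬝ᵥ gain := by
    rw [value_update_sub, dotProduct, dotProduct, Finset.mul_sum]
    refine Finset.sum_le_sum fun s _ => ?_
    rw [← mul_assoc]
    exact (mul_le_mul_of_nonneg_left (le_max_left _ _)
      ((G.visitation_mem_stdSimplex _ ν).1 s)).trans
        (mul_le_mul_of_nonneg_right (visitation_le_mismatch_mul hI hν _ s) (hgain s))
  have hinit : (1 - G.discount) * probVec G.init ⬝ᵥ gain ≤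
      G.visitation π G.init ⬝ᵥ gain := by
    rw [dotProduct, Finset.mul_sum]
    refine Finset.sum_le_sum fun s _ => ?_
    rw [← mul_assoc]
    exact mul_le_mul_of_nonneg_right (G.le_visitation π G.init s) (hgain s)
  rw [← le_inv_mul_iff₀ hp] at hinit
  rw [div_mul_eq_mul_div, le_div_iff₀' hp]
  exact hmismatch.trans (mul_le_mul_of_nonneg_left hinit hD)

theorem value_update_greedy_sub_le [∀ i, Nonempty (A i)] {α : ℝ} (hα : α ∈ Set.Icc (0 : ℝ) 1)
    (x : JointPolicy N S A) (k : N) {B : ℝ}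
    (hB : ∀ y : Policy S (A k), G.policyGradient k (greedyProfile hα x)
      ((greedy α hα y).1 - (greedy α hα (x k)).1) ≤ B)
    {ν : PMF S} (hν : ν ∈ I) (q : Policy S (A k)) :
    G.value k ν (Function.update (greedyProfile hα x) k (greedy α hα q)) -
      G.value k ν (greedyProfile hα x) ≤ G.mismatch I / (1 - G.discount) * B := by
  have hp := G.one_sub_discount_pos
  have hD := zero_le_one.trans (one_le_mismatch hI ⟨ν, hν⟩)
  obtain ⟨y, hy⟩ := G.exists_deviationAdvantage_sub_eq_max k
    (greedyProfile hα x) (x k) q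
  refine (value_update_sub_le hI hν k _ _).trans
    (mul_le_mul_of_nonneg_left (le_of_eq_of_le ?_ (hB y)) (div_nonneg hD hp.le))
  rw [policyGradient_apply, greedy_sub_greedy, greedy_sub_greedy]
  congr 2
  funext s
  simp only [map_smul, Pi.smul_apply, hy, smul_eq_mul]
  rw [mul_max_of_nonneg _ _ (by linarith [hα.2]), mul_zero]

theorem nashGap_greedy_le [∀ i, Nonempty (A i)] (hne : I.Nonempty) {α : ℝ}
    (hα : α ∈ Set.Icc (0 : ℝ) 1) (x x' : JointPolicy N S A) {B : ℝ} (hB0 : 0 ≤ B)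
    (hB : ∀ k, ∀ y : Policy S (A k), G.policyGradient k (greedyProfile hα x')
      ((greedy α hα y).1 - (greedy α hα (x' k)).1) ≤ B) :
    G.nashGap I (greedyProfile hα x) ≤
      2 * α / (1 - G.discount) ^ 2 + G.mismatch I / (1 - G.discount) * B +
        2 * policyDist (greedyProfile hα x) (greedyProfile hα x') /
          (1 - G.discount) ^ 2 := by
  have hp := G.one_sub_discount_pos
  have hD := zero_le_one.trans (one_le_mismatch hI hne)
  have hα0 := hα.1
  set π : JointPolicy N S A := greedyProfile hα x
  set π' : JointPolicy N S A := greedyProfile hα x'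
  have hdist := policyDist_nonneg π π'
  refine csInf_le ⟨0, fun _ h => h.1⟩ ⟨by positivity, fun k p ν hν => ?_⟩
  have hdeviation := (G.abs_value_sub_le k ν (Function.update π k p)
    (Function.update π' k p)).trans (div_le_div_of_nonneg_right
      (policyDist_update_update_self_le π π' k p) (sq_nonneg _))
  have hexplore := (G.abs_value_sub_le k ν (Function.update π' k p)
    (Function.update π' k (greedy α hα p))).trans (div_le_div_of_nonneg_right
      ((policyDist_update_update π' k _ _).trans_le (rowNorm_sub_greedy_le hα p)) (sq_nonneg _))
  have hgradient := value_update_greedy_sub_le hI hα x' k (hB k) hν p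
  have hself := G.abs_value_sub_le k ν π π'
  rw [abs_le] at hdeviation hexplore hself
  rw [two_mul (policyDist π π'), add_div]
  linarith [hdeviation.2, hexplore.2, hself.1]

end GradientDomination

end Game

section ProximalPoint

variable {P E : Type*} [NormedAddCommGroup E]

/-- `z` maximizes `F y - β ‖ι y - ι x‖²`, that is, `z` is a proximal point of `x` for the function
`F`. The domain is a type `P` parametrizing a subset of `E` through `ι`. -/
def IsProximalPoint (ι : P → E) (F : P → ℝ) (β : ℝ) (x z : P) : Prop :=
  ∀ y, F y - β * ‖ι y - ι x‖ ^ 2 ≤ F z - β * ‖ι z - ι x‖ ^ 2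

/-- The Moreau envelope of `F` at `x`; the sign of the penalty is that of a maximization problem. -/
def moreauEnvelope (ι : P → E) (F : P → ℝ) (β : ℝ) (x : P) : ℝ :=
  ⨆ y, F y - β * ‖ι y - ι x‖ ^ 2

theorem exists_isProximalPoint [TopologicalSpace P] [CompactSpace P] {ι : P → E}
    (hι : Continuous ι) {F : P → ℝ} (hF : Continuous F) (β : ℝ) (x : P) :
    ∃ z, IsProximalPoint ι F β x z := by
  obtain ⟨z, -, hz⟩ := isCompact_univ.exists_isMaxOn (f := fun y => F y - β * ‖ι y - ι x‖ ^ 2)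
    ⟨x, Set.mem_univ x⟩ (by fun_prop)
  exact ⟨z, fun y => hz (Set.mem_univ y)⟩

theorem nonpos_of_forall_le_mul {c d : ℝ} (h : ∀ t, 0 < t → t ≤ 1 → d ≤ t * c) : d ≤ 0 := by
  have hlim : Filter.Tendsto (fun t : ℝ => t * c) (nhdsWithin 0 (Set.Ioi 0)) (nhds 0) := by
    simpa using (Filter.tendsto_id.mul_const c).mono_left
      (nhdsWithin_le_nhds (a := (0 : ℝ)) (s := Set.Ioi 0))
  refine ge_of_tendsto hlim ?_
  filter_upwards [Ioc_mem_nhdsGT one_pos] with t ht using h t ht.1 ht.2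

namespace IsProximalPoint

variable {ι : P → E} {F : P → ℝ} {β : ℝ} {x z : P}

theorem moreauEnvelope_eq (hz : IsProximalPoint ι F β x z) :
    moreauEnvelope ι F β x = F z - β * ‖ι z - ι x‖ ^ 2 := by
  have := Nonempty.intro z
  exact le_antisymm (ciSup_le hz) (le_ciSup ⟨_, Set.forall_mem_range.2 hz⟩ z)

theorem le_moreauEnvelope (hz : IsProximalPoint ι F β x z) (y : P) :
    F y - β * ‖ι y - ι x‖ ^ 2 ≤ moreauEnvelope ι F β x :=
  (hz y).trans_eq hz.moreauEnvelope_eq.symm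

variable [InnerProductSpace ℝ E] {L : P → E →ₗ[ℝ] ℝ}

theorem le_inner (hz : IsProximalPoint ι F β x z)
    (hseg : ∀ y, ∀ t ∈ Set.Icc (0 : ℝ) 1, ∃ w, ι w = ι z + t • (ι y - ι z))
    (hβ : ∀ y, |F y - F z - L z (ι y - ι z)| ≤ β / 2 * ‖ι y - ι z‖ ^ 2) (y : P) :
    L z (ι y - ι z) ≤ 2 * β * inner ℝ (ι z - ι x) (ι y - ι z) := by
  rw [← sub_nonpos]
  refine nonpos_of_forall_le_mul (c := 3 / 2 * β * ‖ι y - ι z‖ ^ 2) fun t ht ht1 => ?_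
  obtain ⟨w, hw⟩ := hseg y t ⟨ht.le, ht1⟩
  have hwz : ι w - ι z = t • (ι y - ι z) := by rw [hw]; abel
  have hwx : ι w - ι x = (ι z - ι x) + t • (ι y - ι z) := by rw [hw]; abel
  have hmax := hz w
  have hlower := (abs_le.1 (hβ w)).1
  rw [hwx, norm_add_sq_real, inner_smul_right, norm_smul, mul_pow, Real.norm_eq_abs,
    sq_abs] at hmax
  rw [hwz, map_smul, smul_eq_mul, norm_smul, mul_pow, Real.norm_eq_abs, sq_abs] at hlower
  refine le_of_mul_le_mul_left ?_ ht
  linarith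

theorem mul_norm_sq_le (hz : IsProximalPoint ι F β x z)
    (hseg : ∀ y, ∀ t ∈ Set.Icc (0 : ℝ) 1, ∃ w, ι w = ι z + t • (ι y - ι z))
    (hβ : ∀ x y, |F y - F x - L x (ι y - ι x)| ≤ β / 2 * ‖ι y - ι x‖ ^ 2) :
    β * ‖ι z - ι x‖ ^ 2 ≤ L x (ι z - ι x) := by
  have hopt := hz.le_inner hseg (hβ z) x
  have hupper := (abs_le.1 (hβ z x)).2
  have hlower := (abs_le.1 (hβ x z)).2
  rw [← neg_sub (ι z) (ι x), inner_neg_right, real_inner_self_eq_norm_sq] at hopt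
  rw [← neg_sub (ι z) (ι x), norm_neg] at hupper
  linarith

end IsProximalPoint

end ProximalPoint

section Expectation

/-- The expectation of an extended nonnegative function under a discrete law. -/
def lexpect {B : Type*} (p : PMF B) (f : B → ENNReal) : ENNReal := ∑' b, p b * f b

variable {B C : Type*}

theorem lexpect_mono (p : PMF B) {f g : B → ENNReal} (h : ∀ b, f b ≤ g b) :
    lexpect p f ≤ lexpect p g :=
  ENNReal.tsum_le_tsum fun b => mul_le_mul_right (h b) _

theorem lexpect_const (p : PMF B) (c : ENNReal) : lexpect p (fun _ => c) = c := by
  rw [lexpect, ENNReal.tsum_mul_right, PMF.tsum_coe, one_mul]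

theorem lexpect_add (p : PMF B) (f g : B → ENNReal) :
    lexpect p (fun b => f b + g b) = lexpect p f + lexpect p g := by
  simp only [lexpect, mul_add, ENNReal.tsum_add]

theorem lexpect_const_mul (p : PMF B) (c : ENNReal) (f : B → ENNReal) :
    lexpect p (fun b => c * f b) = c * lexpect p f := by
  simp only [lexpect, mul_left_comm _ c, ENNReal.tsum_mul_left]

theorem lexpect_pure (b : B) (f : B → ENNReal) : lexpect (PMF.pure b) f = f b := by
  rw [lexpect, tsum_eq_single b fun y hy => by simp [PMF.pure_apply, hy]]
  simp

theorem lexpect_bind (p : PMF B) (q : B → PMF C) (f : C → ENNReal) :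
    lexpect (p.bind q) f = lexpect p fun b => lexpect (q b) f := by
  simp_rw [lexpect, PMF.bind_apply, ← ENNReal.tsum_mul_right, ← ENNReal.tsum_mul_left, mul_assoc]
  exact ENNReal.tsum_comm

theorem lexpect_map (p : PMF B) (g : B → C) (f : C → ENNReal) :
    lexpect (p.map g) f = lexpect p fun b => f (g b) := by
  rw [← PMF.bind_pure_comp, lexpect_bind]
  simp only [Function.comp_apply, lexpect_pure]

theorem lexpect_ofReal [Fintype B] (p : PMF B) {f : B → ℝ} (hf : ∀ b, 0 ≤ f b) :
    lexpect p (fun b => ENNReal.ofReal (f b)) = ENNReal.ofReal (probVec p ⬝ᵥ f) := by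
  simp only [lexpect, tsum_fintype, dotProduct, probVec]
  rw [ENNReal.ofReal_sum_of_nonneg fun b _ => mul_nonneg ENNReal.toReal_nonneg (hf b)]
  refine Finset.sum_congr rfl fun b _ => ?_
  rw [ENNReal.ofReal_mul ENNReal.toReal_nonneg, ENNReal.ofReal_toReal (p.apply_ne_top b)]

theorem lexpect_ofReal_le_of_sq_le (p : PMF B) {g δ : B → ℝ} {a c v : ℝ} {ε : ℝ} (hε : 0 < ε)
    (hg : ∀ b, g b ≤ a + c * δ b)
    (hδ : lexpect p (fun b => ENNReal.ofReal (δ b ^ 2)) ≤ ENNReal.ofReal v)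
    (ha : 0 ≤ a) (hv : 0 ≤ v) :
    lexpect p (fun b => ENNReal.ofReal (g b)) ≤ ENNReal.ofReal (a + ε + c ^ 2 * v / (4 * ε)) := by
  have hyoung : ∀ b, g b ≤ (a + ε) + c ^ 2 / (4 * ε) * δ b ^ 2 := fun b => by
    have hsq : 0 ≤ (2 * ε - c * δ b) ^ 2 / (4 * ε) := by positivity
    have hexpand : (2 * ε - c * δ b) ^ 2 / (4 * ε) =
        ε - c * δ b + c ^ 2 / (4 * ε) * δ b ^ 2 := by
      field_simp
      ring
    linarith [hg b]
  calc lexpect p (fun b => ENNReal.ofReal (g b))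
      ≤ lexpect p (fun b => ENNReal.ofReal (a + ε) +
          ENNReal.ofReal (c ^ 2 / (4 * ε)) * ENNReal.ofReal (δ b ^ 2)) :=
        lexpect_mono p fun b => by
          rw [← ENNReal.ofReal_mul (by positivity), ← ENNReal.ofReal_add (by positivity)
            (by positivity)]
          exact ENNReal.ofReal_le_ofReal (hyoung b)
    _ ≤ ENNReal.ofReal (a + ε) + ENNReal.ofReal (c ^ 2 / (4 * ε)) * ENNReal.ofReal v := by
        rw [lexpect_add, lexpect_const, lexpect_const_mul]
        gcongr
    _ = ENNReal.ofReal (a + ε + c ^ 2 * v / (4 * ε)) := by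
        rw [← ENNReal.ofReal_mul (by positivity), ← ENNReal.ofReal_add (by positivity)
          (by positivity), div_mul_eq_mul_div]

end Expectation

namespace Game

section Horizon

variable {N S : Type*} {A : N → Type*} (G : Game N S A)

/-- The probability that a sampled trajectory has horizon `k`. -/
def horizonWeight (k : ℕ) : ℝ := (1 - G.discount) * G.discount ^ k

theorem horizonWeight_nonneg (k : ℕ) : 0 ≤ G.horizonWeight k :=
  mul_nonneg G.one_sub_discount_pos.le (pow_nonneg G.discount_nonneg k)

theorem horizonWeight_succ (k : ℕ) :
    G.horizonWeight (k + 1) = G.discount * G.horizonWeight k := by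
  rw [horizonWeight, horizonWeight, pow_succ']
  ring

theorem hasSum_horizonWeight : HasSum G.horizonWeight 1 := by
  have h := (hasSum_geometric_of_lt_one G.discount_nonneg G.discount_lt_one).mul_left
    (1 - G.discount)
  rwa [mul_inv_cancel₀ G.one_sub_discount_pos.ne'] at h

theorem hasSum_horizonWeight_mul_choose (j : ℕ) :
    HasSum (fun k : ℕ => G.horizonWeight k * ((k + j).choose j : ℝ))
      (1 / (1 - G.discount) ^ j) := by
  have h := (hasSum_choose_mul_geometric_of_norm_lt_one (𝕜 := ℝ) j (r := G.discount) (by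
    rw [Real.norm_eq_abs, abs_of_nonneg G.discount_nonneg]
    exact G.discount_lt_one)).mul_left (1 - G.discount)
  have hlimit : (1 - G.discount) * (1 / (1 - G.discount) ^ (j + 1)) =
      1 / (1 - G.discount) ^ j := by
    rw [pow_succ', mul_one_div, div_mul_cancel_left₀ G.one_sub_discount_pos.ne', one_div]
  have hterm : (fun k => (1 - G.discount) * (((k + j).choose j : ℝ) * G.discount ^ k)) =
      fun k => G.horizonWeight k * ((k + j).choose j : ℝ) := by
    funext k
    rw [horizonWeight]
    ring
  rwa [hlimit, hterm] at h

theorem succ_pow_le_factorial_mul_choose (k j : ℕ) :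
    ((k : ℝ) + 1) ^ j ≤ j.factorial * ((k + j).choose j : ℝ) := by
  have h := Nat.pow_sub_le_descFactorial (k + j) j
  rw [Nat.descFactorial_eq_factorial_mul_choose, show k + j + 1 - j = k + 1 by omega] at h
  exact_mod_cast h

end Horizon

section Trajectories

variable {N S : Type*} {A : N → Type*} [Fintype N] [DecidableEq N] [Fintype S]
  [∀ i, Fintype (A i)] (G : Game N S A)

/-- The expectation of `f` over the trajectories of horizon `k`, as a function of the initial
state; it is the real-valued counterpart of `pathLaw`. -/
def pathExp (π : JointPolicy N S A) : ℕ → (List (S × ∀ i, A i) → ℝ) →ₗ[ℝ] (S → ℝ)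
  | 0 =>
    { toFun f s := profileProb π s ⬝ᵥ fun a => f [(s, a)]
      map_add' f g := funext fun s => dotProduct_add _ _ _
      map_smul' c f := funext fun s => dotProduct_smul _ _ _ }
  | k + 1 =>
    { toFun f s := profileProb π s ⬝ᵥ fun a =>
        G.expectNext (pathExp π k fun l => f ((s, a) :: l)) s a
      map_add' f g := funext fun s => by
        refine Eq.trans (congrArg _ (funext fun a => ?_)) (dotProduct_add _ _ _)
        exact (congrArg _ (map_add (pathExp π k) (fun l => f ((s, a) :: l)) _)).trans
          (dotProduct_add _ _ _)
      map_smul' c f := funext fun s => by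
        refine Eq.trans (congrArg _ (funext fun a => ?_)) (dotProduct_smul c _ _)
        exact (congrArg _ (map_smul (pathExp π k) c fun l => f ((s, a) :: l))).trans
          (dotProduct_smul _ _ _) }

theorem pathExp_zero_apply (π : JointPolicy N S A) (f : List (S × ∀ i, A i) → ℝ) (s : S) :
    G.pathExp π 0 f s = profileProb π s ⬝ᵥ fun a => f [(s, a)] :=
  rfl

theorem pathExp_succ_apply (π : JointPolicy N S A) (k : ℕ) (f : List (S × ∀ i, A i) → ℝ) (s : S) :
    G.pathExp π (k + 1) f s = profileProb π s ⬝ᵥ fun a =>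
      G.expectNext (G.pathExp π k fun l => f ((s, a) :: l)) s a :=
  rfl

theorem pathExp_mono (π : JointPolicy N S A) (k : ℕ) {f g : List (S × ∀ i, A i) → ℝ}
    (h : ∀ l, l.length = k + 1 → f l ≤ g l) (s : S) : G.pathExp π k f s ≤ G.pathExp π k g s := by
  induction k generalizing s f g with
  | zero =>
    exact dotProduct_le_dotProduct_of_nonneg_left (fun a => h _ rfl)
      (profileProb_mem_stdSimplex π s).1
  | succ k ih =>
    refine dotProduct_le_dotProduct_of_nonneg_left (fun a => ?_) (profileProb_mem_stdSimplex π s).1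
    refine dotProduct_le_dotProduct_of_nonneg_left (fun s' => ?_) (probVec_mem_stdSimplex _).1
    exact ih (fun l hl => h _ (by rw [List.length_cons, hl])) s'

theorem pathExp_const (π : JointPolicy N S A) (k : ℕ) (c : ℝ) :
    G.pathExp π k (fun _ => c) = fun _ => c := by
  induction k with
  | zero =>
    exact funext fun s => dotProduct_const_of_mem_stdSimplex (profileProb_mem_stdSimplex π s) c
  | succ k ih =>
    funext s
    simp only [pathExp_succ_apply, ih, expectNext,
      dotProduct_const_of_mem_stdSimplex (probVec_mem_stdSimplex _),
      dotProduct_const_of_mem_stdSimplex (profileProb_mem_stdSimplex π s)]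

theorem pathExp_nonneg (π : JointPolicy N S A) (k : ℕ) {f : List (S × ∀ i, A i) → ℝ}
    (hf : ∀ l, 0 ≤ f l) (s : S) : 0 ≤ G.pathExp π k f s := by
  simpa [pathExp_const] using G.pathExp_mono π k (f := fun _ => 0) (fun l _ => hf l) s

theorem abs_pathExp_le (π : JointPolicy N S A) (k : ℕ) {f : List (S × ∀ i, A i) → ℝ} {M : ℝ}
    (h : ∀ l, l.length = k + 1 → |f l| ≤ M) (s : S) : |G.pathExp π k f s| ≤ M := by
  rw [abs_le]
  constructor
  · simpa [pathExp_const] using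
      G.pathExp_mono π k (f := fun _ => -M) (fun l hl => (abs_le.1 (h l hl)).1) s
  · simpa [pathExp_const] using
      G.pathExp_mono π k (g := fun _ => M) (fun l hl => (abs_le.1 (h l hl)).2) s

theorem lexpect_pathLaw_ofReal (π : JointPolicy N S A) (k : ℕ) {f : List (S × ∀ i, A i) → ℝ}
    (hf : ∀ l, 0 ≤ f l) (s : S) :
    lexpect (G.pathLaw π k s) (fun l => ENNReal.ofReal (f l)) =
      ENNReal.ofReal (G.pathExp π k f s) := by
  induction k generalizing s f with
  | zero =>
    rw [pathLaw, lexpect_map, lexpect_ofReal _ fun a => hf _, probVec_actionLaw,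
      pathExp_zero_apply]
  | succ k ih =>
    have hnonneg : ∀ a s', 0 ≤ G.pathExp π k (fun l => f ((s, a) :: l)) s' := fun a =>
      G.pathExp_nonneg π k fun _ => hf _
    simp only [pathLaw, lexpect_bind, lexpect_map]
    simp only [ih fun _ => hf _, lexpect_ofReal _ (hnonneg _)]
    rw [lexpect_ofReal _ fun a => dotProduct_nonneg_of_nonneg (probVec_mem_stdSimplex _).1
      (hnonneg a), probVec_actionLaw]
    rfl

/-- `u s` is the expectation of `f` over the trajectories of `π` with geometric horizon that start
at `s`, the expectation over the horizon being absolutely convergent. -/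
def HasTrajectoryExp (π : JointPolicy N S A) (f : List (S × ∀ i, A i) → ℝ) (u : S → ℝ) : Prop :=
  HasSum (fun k => G.horizonWeight k • G.pathExp π k f) u

theorem exists_hasTrajectoryExp (π : JointPolicy N S A) {f : List (S × ∀ i, A i) → ℝ} (j : ℕ)
    {C : ℝ} (hC : 0 ≤ C) (hf : ∀ l, |f l| ≤ C * (l.length : ℝ) ^ j) :
    ∃ u, G.HasTrajectoryExp π f u := by
  refine ⟨_, (Pi.summable.2 fun s => Summable.of_norm_bounded
    ((G.hasSum_horizonWeight_mul_choose j).summable.mul_left (C * j.factorial)) fun k => ?_).hasSum⟩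
  rw [Pi.smul_apply, smul_eq_mul, norm_mul, Real.norm_of_nonneg (G.horizonWeight_nonneg k),
    mul_left_comm, mul_assoc]
  refine mul_le_mul_of_nonneg_left ?_ (G.horizonWeight_nonneg k)
  refine (G.abs_pathExp_le π k (fun l hl => ?_) s).trans
    (mul_le_mul_of_nonneg_left (succ_pow_le_factorial_mul_choose k j) hC)
  simpa [hl] using hf l

namespace HasTrajectoryExp

variable {G} {π : JointPolicy N S A} {f g : List (S × ∀ i, A i) → ℝ} {u v : S → ℝ}

theorem const (c : ℝ) : G.HasTrajectoryExp π (fun _ => c) fun _ => c := by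
  simp only [HasTrajectoryExp, pathExp_const]
  refine Pi.hasSum.2 fun s => ?_
  simpa using G.hasSum_horizonWeight.mul_right c

theorem add (hf : G.HasTrajectoryExp π f u) (hg : G.HasTrajectoryExp π g v) :
    G.HasTrajectoryExp π (f + g) (u + v) := by
  simpa only [HasTrajectoryExp, map_add, smul_add] using HasSum.add hf hg

theorem const_smul (hf : G.HasTrajectoryExp π f u) (c : ℝ) :
    G.HasTrajectoryExp π (c • f) (c • u) := by
  simpa only [HasTrajectoryExp, map_smul, smul_comm _ c] using HasSum.const_smul c hf

theorem sum {B : Type*} {T : Finset B} {f : B → List (S × ∀ i, A i) → ℝ} {u : B → S → ℝ}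
    (h : ∀ b ∈ T, G.HasTrajectoryExp π (f b) (u b)) :
    G.HasTrajectoryExp π (∑ b ∈ T, f b) (∑ b ∈ T, u b) := by
  simpa only [HasTrajectoryExp, map_sum, Finset.smul_sum] using hasSum_sum h

/-- The geometric horizon is memoryless: with probability `discount` a trajectory that has visited
its first state continues as a fresh trajectory from the next state. -/
theorem cons {u : S → (∀ i, A i) → S → ℝ}
    (h : ∀ s a, G.HasTrajectoryExp π (fun l => f ((s, a) :: l)) (u s a)) :
    G.HasTrajectoryExp π f fun s => profileProb π s ⬝ᵥ fun a =>
      (1 - G.discount) * f [(s, a)] + G.discount * G.expectNext (u s a) s a := by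
  refine Pi.hasSum.2 fun s => (hasSum_nat_add_iff' 1).1 ?_
  have htail : HasSum (fun k => profileProb π s ⬝ᵥ fun a => G.discount * G.expectNext
      (G.horizonWeight k • G.pathExp π k fun l => f ((s, a) :: l)) s a)
      (profileProb π s ⬝ᵥ fun a => G.discount * G.expectNext (u s a) s a) :=
    hasSum_sum fun a _ => ((hasSum_sum fun s' _ =>
      (Pi.hasSum.1 (h s a) s').mul_left _).mul_left _).mul_left _
  have hshift : (fun k => (G.horizonWeight (k + 1) • G.pathExp π (k + 1) f) s) =
      fun k => profileProb π s ⬝ᵥ fun a => G.discount * G.expectNext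
        (G.horizonWeight k • G.pathExp π k fun l => f ((s, a) :: l)) s a := by
    funext k
    simp only [Pi.smul_apply, smul_eq_mul, horizonWeight_succ, pathExp_succ_apply, expectNext,
      dotProduct, Finset.mul_sum]
    exact Finset.sum_congr rfl fun a _ => Finset.sum_congr rfl fun s' _ => by ring
  have hhead : (G.horizonWeight 0 • G.pathExp π 0 f) s =
      profileProb π s ⬝ᵥ fun a => (1 - G.discount) * f [(s, a)] := by
    rw [Pi.smul_apply, pathExp_zero_apply, horizonWeight, pow_zero, mul_one, ← dotProduct_smul]
    rfl
  rw [hshift, Finset.sum_range_one, hhead, ← dotProduct_sub]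
  simp only [Pi.sub_def, add_sub_cancel_left]
  exact htail

theorem bellman {w : S → (∀ i, A i) → S → ℝ} (hf : G.HasTrajectoryExp π f u)
    (h : ∀ s a, G.HasTrajectoryExp π (fun l => f ((s, a) :: l)) (w s a + u)) :
    u - G.discount • (G.transitionMatrix π *ᵥ u) = fun s => profileProb π s ⬝ᵥ fun a =>
      (1 - G.discount) * f [(s, a)] + G.discount * G.expectNext (w s a) s a := by
  rw [sub_eq_iff_eq_add]
  refine (HasSum.unique hf (cons h)).trans (funext fun s => ?_)
  rw [Pi.add_apply, Pi.smul_apply, transitionMatrix_mulVec, ← dotProduct_smul, ← dotProduct_add]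
  congr 1
  funext a
  simp only [expectNext, dotProduct_add, Pi.add_apply, Pi.smul_apply, smul_eq_mul]
  ring

theorem le_of_pathExp_le (hf : G.HasTrajectoryExp π f u) (j : ℕ) {M : ℝ} (hM : 0 ≤ M)
    (h : ∀ k s, G.pathExp π k f s ≤ M * ((k : ℝ) + 1) ^ j) (s : S) :
    u s ≤ j.factorial * M / (1 - G.discount) ^ j := by
  rw [← mul_one_div]
  refine hasSum_le (fun k => ?_) (Pi.hasSum.1 hf s)
    ((G.hasSum_horizonWeight_mul_choose j).mul_left (j.factorial * M))
  rw [Pi.smul_apply, smul_eq_mul, mul_left_comm, mul_comm (j.factorial : ℝ), mul_assoc]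
  exact mul_le_mul_of_nonneg_left ((h k s).trans
    (mul_le_mul_of_nonneg_left (succ_pow_le_factorial_mul_choose k j) hM))
    (G.horizonWeight_nonneg k)

theorem lexpect_ofReal (hf : G.HasTrajectoryExp π f u) (h0 : ∀ l, 0 ≤ f l) :
    lexpect (G.trajectoryLaw π) (fun l => ENNReal.ofReal (f l)) =
      ENNReal.ofReal (probVec G.init ⬝ᵥ u) := by
  have hnonneg : ∀ k s, 0 ≤ G.pathExp π k f s := fun k => G.pathExp_nonneg π k h0
  have hsum : HasSum (fun k => G.horizonWeight k * probVec G.init ⬝ᵥ G.pathExp π k f)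
      (probVec G.init ⬝ᵥ u) := by
    simpa only [dotProduct, Finset.mul_sum, Pi.smul_apply, smul_eq_mul, mul_left_comm] using
      hasSum_sum fun s (_ : s ∈ Finset.univ) => (Pi.hasSum.1 hf s).mul_left (probVec G.init s)
  have hinit : ∀ k, 0 ≤ probVec G.init ⬝ᵥ G.pathExp π k f := fun k =>
    dotProduct_nonneg_of_nonneg (probVec_mem_stdSimplex _).1 (hnonneg k)
  simp only [trajectoryLaw, lexpect_bind, G.lexpect_pathLaw_ofReal π _ h0]
  simp only [MarkovGame.lexpect_ofReal _ (hnonneg _)]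
  rw [← hsum.tsum_eq, ENNReal.ofReal_tsum_of_nonneg
    (fun k => mul_nonneg (G.horizonWeight_nonneg k) (hinit k)) hsum.summable]
  exact tsum_congr fun k => (ENNReal.ofReal_mul (G.horizonWeight_nonneg k)).symm

end HasTrajectoryExp

end Trajectories

section PathSum

variable {N S : Type*} {A : N → Type*}

/-- The sum of `h` along a trajectory. -/
def pathSum (h : S → (∀ i, A i) → ℝ) (l : List (S × ∀ i, A i)) : ℝ :=
  (l.map fun z => h z.1 z.2).sum

theorem pathSum_cons (h : S → (∀ i, A i) → ℝ) (s : S) (a : ∀ i, A i)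
    (l : List (S × ∀ i, A i)) : pathSum h ((s, a) :: l) = h s a + pathSum h l := by
  simp [pathSum]

theorem pathSum_singleton (h : S → (∀ i, A i) → ℝ) (s : S) (a : ∀ i, A i) :
    pathSum h [(s, a)] = h s a := by
  simp [pathSum]

theorem abs_pathSum_le {h : S → (∀ i, A i) → ℝ} {C : ℝ} (hC : ∀ s a, |h s a| ≤ C)
    (l : List (S × ∀ i, A i)) : |pathSum h l| ≤ C * l.length := by
  induction l with
  | nil => simp [pathSum]
  | cons z l ih =>
    rw [pathSum_cons]
    refine (abs_add_le _ _).trans ((add_le_add (hC _ _) ih).trans_eq ?_)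
    push_cast [List.length_cons]
    ring

theorem exists_forall_abs_le [Finite N] [Finite S] [∀ i, Finite (A i)] (h : S → (∀ i, A i) → ℝ) :
    ∃ C, 0 ≤ C ∧ ∀ s a, |h s a| ≤ C := by
  obtain ⟨C, hC⟩ := (Set.finite_range fun z : S × ∀ i, A i => |h z.1 z.2|).bddAbove
  exact ⟨max C 0, le_max_right _ _, fun s a =>
    (hC (Set.mem_range_self (s, a))).trans (le_max_left _ _)⟩

variable [Fintype N] [DecidableEq N] [Fintype S] [∀ i, Fintype (A i)] (G : Game N S A)

theorem pathExp_pathSum_le (π : JointPolicy N S A) {h : S → (∀ i, A i) → ℝ} {M : ℝ}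
    (hM : ∀ s, profileProb π s ⬝ᵥ h s ≤ M) (k : ℕ) (s : S) :
    G.pathExp π k (pathSum h) s ≤ M * (k + 1) := by
  induction k generalizing s with
  | zero => simpa [pathExp_zero_apply, pathSum_singleton] using hM s
  | succ k ih =>
    have hnext : ∀ a, G.expectNext (G.pathExp π k fun l => pathSum h ((s, a) :: l)) s a ≤
        h s a + M * (k + 1) := fun a => by
      have hcons : (fun l => pathSum h ((s, a) :: l)) = (fun _ => h s a) + pathSum h :=
        funext fun l => pathSum_cons h s a l
      rw [hcons, map_add, pathExp_const, expectNext, dotProduct_add,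
        dotProduct_const_of_mem_stdSimplex (probVec_mem_stdSimplex _)]
      gcongr
      refine (dotProduct_le_dotProduct_of_nonneg_left ih (probVec_mem_stdSimplex _).1).trans_eq ?_
      exact dotProduct_const_of_mem_stdSimplex (probVec_mem_stdSimplex _) _
    calc G.pathExp π (k + 1) (pathSum h) s
        ≤ profileProb π s ⬝ᵥ (h s + fun _ => M * (k + 1)) :=
          dotProduct_le_dotProduct_of_nonneg_left hnext (profileProb_mem_stdSimplex π s).1
      _ ≤ M + M * (k + 1) := by
          rw [dotProduct_add, dotProduct_const_of_mem_stdSimplex (profileProb_mem_stdSimplex π s)]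
          gcongr
          exact hM s
      _ = M * ((k + 1 : ℕ) + 1) := by
          push_cast
          ring

theorem exists_hasTrajectoryExp_pathSum (π : JointPolicy N S A) (h : S → (∀ i, A i) → ℝ) :
    ∃ u, G.HasTrajectoryExp π (pathSum h) u :=
  have ⟨_, hC, hle⟩ := exists_forall_abs_le h
  G.exists_hasTrajectoryExp π 1 hC fun l => by simpa using abs_pathSum_le hle l

variable {G} {π : JointPolicy N S A} {h : S → (∀ i, A i) → ℝ} {u : S → ℝ}

theorem HasTrajectoryExp.pathSum_bellman (hu : G.HasTrajectoryExp π (pathSum h) u) :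
    u - G.discount • (G.transitionMatrix π *ᵥ u) = fun s => profileProb π s ⬝ᵥ h s := by
  rw [hu.bellman (w := fun s a _ => h s a) fun s a => ?_]
  · simp only [pathSum_singleton, expectNext,
      dotProduct_const_of_mem_stdSimplex (probVec_mem_stdSimplex _), ← add_mul,
      sub_add_cancel, one_mul]
  · rw [funext fun l => pathSum_cons h s a l]
    exact (HasTrajectoryExp.const _).add hu

theorem hasTrajectoryExp_pathSum (hu : u - G.discount • (G.transitionMatrix π *ᵥ u) =
    fun s => profileProb π s ⬝ᵥ h s) : G.HasTrajectoryExp π (pathSum h) u := by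
  obtain ⟨v, hv⟩ := G.exists_hasTrajectoryExp_pathSum π h
  rwa [G.bellman_unique hu hv.pathSum_bellman]

theorem hasTrajectoryExp_pathSum_reward (i : N) :
    G.HasTrajectoryExp π (pathSum (G.reward i)) (G.valueVec i π) :=
  hasTrajectoryExp_pathSum (G.valueVec_bellman i π)

/-- Scores are centred, so a score is uncorrelated with the earlier rewards; what it collects from
the current and later ones is the action value. -/
theorem exists_hasTrajectoryExp_reward_mul (i : N) (hh : ∀ s, profileProb π s ⬝ᵥ h s = 0) :
    ∃ u, G.HasTrajectoryExp π (fun l => pathSum (G.reward i) l * pathSum h l) u ∧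
      u - G.discount • (G.transitionMatrix π *ᵥ u) =
        fun s => profileProb π s ⬝ᵥ (h s * G.actionValue i π s) := by
  have hreward := G.hasTrajectoryExp_pathSum_reward (π := π) i
  have hzero : G.HasTrajectoryExp π (pathSum h) 0 :=
    hasTrajectoryExp_pathSum (by simp [hh]; rfl)
  obtain ⟨u, hu⟩ : ∃ u, G.HasTrajectoryExp π (fun l => pathSum (G.reward i) l * pathSum h l) u := by
    obtain ⟨C, hC, hle⟩ := exists_forall_abs_le h
    refine G.exists_hasTrajectoryExp π 2 hC fun l => ?_
    rw [abs_mul]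
    refine (mul_le_mul (abs_pathSum_le (G.abs_reward_le i) l)
      (abs_pathSum_le hle l) (abs_nonneg _) (by positivity)).trans_eq ?_
    ring
  refine ⟨u, hu, ?_⟩
  rw [hu.bellman (w := fun s a => (fun _ => G.reward i s a * h s a) + h s a • G.valueVec i π)
    fun s a => ?_]
  · funext s
    congr 1
    funext a
    simp only [pathSum_singleton, expectNext, dotProduct_add, dotProduct_smul,
      dotProduct_const_of_mem_stdSimplex (probVec_mem_stdSimplex _), Pi.mul_apply, actionValue,
      Pi.add_apply, Pi.smul_apply, smul_eq_mul]
    ring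
  · have hexpand : (fun l => pathSum (G.reward i) ((s, a) :: l) * pathSum h ((s, a) :: l)) =
        (fun _ => G.reward i s a * h s a) + h s a • pathSum (G.reward i) +
          G.reward i s a • pathSum h + fun l => pathSum (G.reward i) l * pathSum h l := by
      funext l
      simp only [pathSum_cons, Pi.add_apply, Pi.smul_apply, smul_eq_mul]
      ring
    rw [hexpand]
    simpa using (((HasTrajectoryExp.const _).add (hreward.const_smul (h s a))).add
      (hzero.const_smul (G.reward i s a))).add hu

end PathSum

end Game

section PolicySet

variable {S B : Type*} [Fintype B]

theorem convex_policySet : Convex ℝ (policySet S B) := by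
  intro x hx y hy a b ha hb hab
  refine ⟨fun s c => ?_, fun s => ?_⟩
  · simp only [PiLp.add_apply, PiLp.smul_apply, smul_eq_mul]
    exact add_nonneg (mul_nonneg ha (hx.1 s c)) (mul_nonneg hb (hy.1 s c))
  · simp only [PiLp.add_apply, PiLp.smul_apply, smul_eq_mul, Finset.sum_add_distrib,
      ← Finset.mul_sum, hx.2 s, hy.2 s, mul_one, hab]

instance compactSpace_policy [Finite S] : CompactSpace (Policy S B) := by
  cases nonempty_fintype S
  rw [← isCompact_iff_compactSpace]
  refine Metric.isCompact_of_isClosed_isBounded (isClosed_policySet S B)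
    (Metric.isBounded_iff.2 ⟨√(4 * Fintype.card S), fun x hx y hy => ?_⟩)
  rw [dist_eq_norm]
  exact Real.le_sqrt_of_sq_le (norm_policy_sub_sq_le ⟨x, hx⟩ ⟨y, hy⟩)

theorem norm_sub_proj_le [Fintype S] [Nonempty B] (v : EuclideanSpace ℝ (S × B)) (y : Policy S B) :
    ‖y.1 - (proj v).1‖ ≤ ‖y.1 - v‖ := by
  have hmin : ∀ y : Policy S B, ‖v - (proj v).1‖ ≤ ‖v - y.1‖ :=
    (exists_closest_policy v).choose_spec
  have : Nonempty (policySet S B) := ⟨proj v⟩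
  have hinf : ‖v - (proj v).1‖ = ⨅ w : policySet S B, ‖v - w‖ :=
    le_antisymm (le_ciInf hmin)
      (ciInf_le ⟨0, by rintro _ ⟨w, rfl⟩; exact norm_nonneg _⟩ (proj v))
  have hobtuse := (norm_eq_iInf_iff_real_inner_le_zero convex_policySet (proj v).2).1 hinf y.1 y.2
  refine le_of_sq_le_sq ?_ (norm_nonneg _)
  rw [← sub_sub_sub_cancel_right y.1 v (proj v).1, norm_sub_sq_real (y.1 - (proj v).1),
    real_inner_comm (v - (proj v).1) (y.1 - (proj v).1)]
  linarith [sq_nonneg ‖v - (proj v).1‖]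

theorem gradient_log_greedy [Fintype S] [Nonempty B] [DecidableEq (S × B)] {α : ℝ}
    (hα : α ∈ Set.Icc (0 : ℝ) 1) (hα0 : 0 < α) (p : Policy S B) (z : S × B) :
    gradient (fun y : EuclideanSpace ℝ (S × B) =>
      Real.log ((1 - α) * y z + α / Fintype.card B)) p.1 =
      ((1 - α) / (greedy α hα p).1 z) • EuclideanSpace.single z (1 : ℝ) := by
  refine HasGradientAt.gradient (hasGradientAt_iff_hasFDerivAt.2 ?_)
  have hcoord : HasFDerivAt (fun y : EuclideanSpace ℝ (S × B) => y z)
      (EuclideanSpace.proj z : EuclideanSpace ℝ (S × B) →L[ℝ] ℝ) p.1 :=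
    (EuclideanSpace.proj z : EuclideanSpace ℝ (S × B) →L[ℝ] ℝ).hasFDerivAt
  refine (((hcoord.const_mul (1 - α)).add_const (α / Fintype.card B)).log
    (greedy_pos hα hα0 p z).ne').congr_fderiv (ContinuousLinearMap.ext fun v => ?_)
  simp only [InnerProductSpace.toDual_apply_apply, inner_smul_left,
    EuclideanSpace.inner_single_left, smul_apply, smul_eq_mul, greedy, conj_trivial, one_mul]
  rw [PiLp.proj_apply, div_eq_mul_inv]
  ring

end PolicySet

theorem norm_list_sum_sq_le {B E : Type*} [SeminormedAddCommGroup E] (f : B → E) (l : List B) :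
    ‖(l.map f).sum‖ ^ 2 ≤ l.length * (l.map fun b => ‖f b‖ ^ 2).sum := by
  rw [← Fin.sum_univ_fun_getElem, ← Fin.sum_univ_fun_getElem]
  refine (pow_le_pow_left₀ (norm_nonneg _) (norm_sum_le _ _) 2).trans ?_
  simpa using sq_sum_le_card_mul_sum_sq (s := (Finset.univ : Finset (Fin l.length)))
    (f := fun k => ‖f l[k.1]‖)

section ParameterSpace

variable {N S : Type*} {A : N → Type*}

/-- The Euclidean space of the joint parameters of all agents. -/
abbrev ParamSpace (N S : Type*) (A : N → Type*) : Type _ :=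
  PiLp 2 fun i : N => EuclideanSpace ℝ (S × A i)

variable [∀ i, Fintype (A i)]

/-- The joint parameters as points of a Euclidean space. -/
def paramEmbed (x : JointPolicy N S A) : ParamSpace N S A := WithLp.toLp 2 fun i => (x i).1

theorem continuous_paramEmbed : Continuous (paramEmbed : JointPolicy N S A → ParamSpace N S A) := by
  unfold paramEmbed
  fun_prop

theorem exists_paramEmbed_segment (x y : JointPolicy N S A) {t : ℝ} (ht : t ∈ Set.Icc (0 : ℝ) 1) :
    ∃ z : JointPolicy N S A, paramEmbed z = paramEmbed x + t • (paramEmbed y - paramEmbed x) :=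
  ⟨fun i => ⟨(x i).1 + t • ((y i).1 - (x i).1),
    convex_policySet.add_smul_sub_mem (x i).2 (y i).2 ht⟩, rfl⟩

variable [Fintype N] [Fintype S]

theorem norm_paramEmbed_sub_sq (x y : JointPolicy N S A) :
    ‖paramEmbed x - paramEmbed y‖ ^ 2 = ∑ i, ‖(x i).1 - (y i).1‖ ^ 2 :=
  PiLp.norm_sq_eq_of_L2 _ _

theorem norm_paramEmbed_update_sub_le [DecidableEq N] (z : JointPolicy N S A) (i : N)
    (y : Policy S (A i)) :
    ‖paramEmbed (Function.update z i y) - paramEmbed z‖ ≤ 2 * √(Fintype.card S) := by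
  refine le_of_sq_le_sq ?_ (by positivity)
  rw [norm_paramEmbed_sub_sq, mul_pow, Real.sq_sqrt (Nat.cast_nonneg _),
    Finset.sum_eq_single i (fun j _ hj => by simp [Function.update_of_ne hj]) (by simp),
    Function.update_self]
  exact (norm_policy_sub_sq_le y (z i)).trans_eq (by norm_num)

end ParameterSpace

section Score

variable {N S : Type*} {A : N → Type*} [Fintype N] [∀ i, Fintype (A i)]

theorem card_le_maxActions (i : N) : Fintype.card (A i) ≤ maxActions N A :=
  Finset.le_sup (f := fun i => Fintype.card (A i)) (Finset.mem_univ i)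

theorem one_le_maxActions (N : Type*) (A : N → Type*) [Fintype N] [∀ i, Fintype (A i)] [Nonempty N]
    [∀ i, Nonempty (A i)] : 1 ≤ maxActions N A :=
  have ⟨i⟩ := ‹Nonempty N›
  Fintype.card_pos.trans_le (card_le_maxActions (A := A) i)

variable [DecidableEq N]

theorem profileProb_mul (π : JointPolicy N S A) (k : N) (v : EuclideanSpace ℝ (S × A k)) (s : S)
    (a : ∀ i, A i) :
    profileProb π s a * v (s, a k) = (π k).1 (s, a k) * deviationWeight π k s v a := by
  rw [profileProb_eq_deviationWeight π k, deviationWeight, LinearMap.coe_mk, AddHom.coe_mk,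
    prodWeight_update, prodWeight_update, row, row]
  ring

variable [∀ i, Nonempty (A i)] {α : ℝ} (hα : α ∈ Set.Icc (0 : ℝ) 1) (hα0 : 0 < α)

/-- The derivative in direction `v` of `log π_i(a_i | s)`, where `π_i` is the `α`-greedy policy
with parameter `p`. -/
def score {i : N} (p : Policy S (A i)) (v : EuclideanSpace ℝ (S × A i)) (s : S)
    (a : ∀ i, A i) : ℝ :=
  (1 - α) / (greedy α hα p).1 (s, a i) * v (s, a i)

include hα0

theorem profileProb_mul_score (x : JointPolicy N S A) (i : N) (v : EuclideanSpace ℝ (S × A i))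
    (s : S) :
    profileProb (greedyProfile hα x) s * score hα (x i) v s =
      (1 - α) • deviationWeight (greedyProfile hα x) i s v := by
  funext a
  have hpos := greedy_pos hα hα0 (x i) (s, a i)
  rw [Pi.mul_apply, score, mul_left_comm, profileProb_mul, ← mul_assoc,
    div_mul_cancel₀ _ hpos.ne', Pi.smul_apply, smul_eq_mul]

theorem profileProb_dotProduct_score_sq_le [Finite S] (x : JointPolicy N S A) (i : N) (s : S) :
    profileProb (greedyProfile hα x) s ⬝ᵥ
      (fun a => ((1 - α) / (greedy α hα (x i)).1 (s, a i)) ^ 2) ≤ maxActions N A ^ 2 / α := by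
  have hpos := greedy_pos hα hα0 (x i)
  have hcard : (Fintype.card (A i) : ℝ) ≤ maxActions N A := by
    exact_mod_cast card_le_maxActions i
  set w : EuclideanSpace ℝ (S × A i) := WithLp.toLp 2 fun z => ((greedy α hα (x i)).1 z)⁻¹ with hw
  have hentry : ∀ z, |w z| ≤ maxActions N A / α := fun z => by
    have hcard0 : (0 : ℝ) < Fintype.card (A i) := Nat.cast_pos.2 Fintype.card_pos
    rw [abs_of_pos (inv_pos.2 (hpos z)), ← inv_div]
    refine inv_anti₀ (div_pos hα0 (hcard0.trans_le hcard))
      (le_trans ?_ (div_card_le_greedy hα (x i) z))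
    gcongr
  have hrowNorm : rowNorm w ≤ maxActions N A ^ 2 / α := by
    refine rowNorm_le (by positivity) fun s => ?_
    refine (Finset.sum_le_sum fun b _ => hentry (s, b)).trans ?_
    rw [Finset.sum_const, Finset.card_univ, nsmul_eq_mul, sq, mul_div_assoc]
    gcongr
  have hweight : (profileProb (greedyProfile hα x) s ⬝ᵥ
      fun a => ((1 - α) / (greedy α hα (x i)).1 (s, a i)) ^ 2) =
        (1 - α) ^ 2 * ∑ a, deviationWeight (greedyProfile hα x) i s w a := by
    rw [dotProduct, Finset.mul_sum]
    refine Finset.sum_congr rfl fun a _ => ?_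
    have h := profileProb_mul (greedyProfile hα x) i w s a
    rw [hw, mul_inv_eq_iff_eq_mul₀ (hpos (s, a i)).ne'] at h
    rw [h, ← hw]
    field [(hpos (s, a i)).ne']
  have hsum := (Finset.sum_le_sum fun a _ => le_abs_self _).trans
    (sum_abs_deviationWeight_le (greedyProfile hα x) i s w)
  rw [hweight]
  exact (mul_le_mul_of_nonneg_left (hsum.trans hrowNorm) (sq_nonneg _)).trans
    (mul_le_of_le_one_left (by positivity) (pow_le_one₀ (by linarith [hα.2]) (by linarith)))

end Score

namespace Game

section GradientEstimate

variable {N S : Type*} {A : N → Type*} [Fintype S] [∀ i, Fintype (A i)] (G : Game N S A)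
  {α : ℝ}

section Agent

variable [∀ i, Nonempty (A i)]

theorem inner_gradEstimate (hα : α ∈ Set.Icc (0 : ℝ) 1) (hα0 : 0 < α) (i : N)
    (p : Policy S (A i)) (v : EuclideanSpace ℝ (S × A i)) (l : List (S × ∀ i, A i)) :
    inner ℝ (G.gradEstimate α i p l) v =
      pathSum (G.reward i) l * pathSum (score hα p v) l := by
  classical
  rw [gradEstimate, inner_smul_left, conj_trivial]
  congr 1
  induction l with
  | nil => simp [pathSum]
  | cons z l ih =>
    obtain ⟨s, a⟩ := z
    rw [List.map_cons, List.sum_cons, inner_add_left, ih, pathSum_cons,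
      gradient_log_greedy hα hα0, inner_smul_left, EuclideanSpace.inner_single_left]
    simp [score]

theorem norm_gradEstimate_sq_le (hα : α ∈ Set.Icc (0 : ℝ) 1) (hα0 : 0 < α) (i : N)
    (p : Policy S (A i)) (l : List (S × ∀ i, A i)) :
    ‖G.gradEstimate α i p l‖ ^ 2 ≤ (l.length : ℝ) ^ 3 *
      pathSum (fun s a => ((1 - α) / (greedy α hα p).1 (s, a i)) ^ 2) l := by
  classical
  set g : S × (∀ i, A i) → EuclideanSpace ℝ (S × A i) := fun z =>
    gradient (fun y : EuclideanSpace ℝ (S × A i) =>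
      Real.log ((1 - α) * y (z.1, z.2 i) + α / Fintype.card (A i))) p.1
  have hg : ∀ z, ‖g z‖ ^ 2 = ((1 - α) / (greedy α hα p).1 (z.1, z.2 i)) ^ 2 := fun z => by
    rw [show g z = _ from gradient_log_greedy hα hα0 p _, norm_smul, PiLp.norm_single, norm_one,
      mul_one, Real.norm_eq_abs, sq_abs]
  have hreward : ‖pathSum (G.reward i) l‖ ^ 2 ≤ (l.length : ℝ) ^ 2 :=
    pow_le_pow_left₀ (norm_nonneg _) (by simpa using abs_pathSum_le (G.abs_reward_le i) l) 2
  calc ‖G.gradEstimate α i p l‖ ^ 2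
      = ‖pathSum (G.reward i) l‖ ^ 2 * ‖(l.map g).sum‖ ^ 2 := by
        rw [← mul_pow, ← norm_smul]
        rfl
    _ ≤ (l.length : ℝ) ^ 2 * (l.length * (l.map fun z => ‖g z‖ ^ 2).sum) := by
        gcongr
        exact norm_list_sum_sq_le g l
    _ = (l.length : ℝ) ^ 3 *
          pathSum (fun s a => ((1 - α) / (greedy α hα p).1 (s, a i)) ^ 2) l := by
        simp only [hg, pathSum]
        ring

end Agent

/-- The gradient estimates of all agents, as a single vector. -/
def jointGradEstimate (α : ℝ) (x : JointPolicy N S A) (l : List (S × ∀ i, A i)) :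
    ParamSpace N S A :=
  WithLp.toLp 2 fun i => G.gradEstimate α i (x i) l

variable [Fintype N]

theorem norm_jointGradEstimate_sq (α : ℝ) (x : JointPolicy N S A) (l : List (S × ∀ i, A i)) :
    ‖G.jointGradEstimate α x l‖ ^ 2 = ∑ i, ‖G.gradEstimate α i (x i) l‖ ^ 2 :=
  PiLp.norm_sq_eq_of_L2 _ _

theorem inner_jointGradEstimate (α : ℝ) (x y z : JointPolicy N S A) (l : List (S × ∀ i, A i)) :
    inner ℝ (G.jointGradEstimate α x l) (paramEmbed y - paramEmbed z) =
      ∑ i, inner ℝ (G.gradEstimate α i (x i) l) ((y i).1 - (z i).1) :=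
  rfl

/-- A bound on the second moment of `jointGradEstimate`. -/
def gradientMoment (α : ℝ) : ℝ :=
  Fintype.card N * (24 * maxActions N A ^ 2 / (α * (1 - G.discount) ^ 4))

omit [Fintype S] in
theorem gradientMoment_nonneg (hα : 0 ≤ α) : 0 ≤ G.gradientMoment α := by
  have hp := G.one_sub_discount_pos
  unfold gradientMoment
  positivity

variable [∀ i, Nonempty (A i)]

theorem norm_paramEmbed_sub_step_sq_le (α η : ℝ) (x z : JointPolicy N S A)
    (l : List (S × ∀ i, A i)) :
    ‖paramEmbed z - paramEmbed (G.step α η x l)‖ ^ 2 ≤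
      ‖paramEmbed z - paramEmbed x - η • G.jointGradEstimate α x l‖ ^ 2 := by
  rw [norm_paramEmbed_sub_sq, PiLp.norm_sq_eq_of_L2]
  refine Finset.sum_le_sum fun i _ => pow_le_pow_left₀ (norm_nonneg _) ?_ 2
  refine (norm_sub_proj_le _ (z i)).trans_eq ?_
  rw [sub_add_eq_sub_sub]
  rfl

variable [DecidableEq N] (hα : α ∈ Set.Icc (0 : ℝ) 1)

/-- The derivative of the mean potential as a function of the parameters of the `α`-greedy
policies. -/
def paramGradient (x : JointPolicy N S A) : ParamSpace N S A →ₗ[ℝ] ℝ :=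
  (1 - α) • ∑ i, G.policyGradient i (greedyProfile hα x) ∘ₗ PiLp.projₗ 2 _ i

theorem paramGradient_sub (x y z : JointPolicy N S A) :
    G.paramGradient hα x (paramEmbed y - paramEmbed z) =
      ∑ i, G.policyGradient i (greedyProfile hα x)
        ((greedy α hα (y i)).1 - (greedy α hα (z i)).1) := by
  simp only [greedy_sub_greedy, map_smul, ← Finset.smul_sum, paramGradient, LinearMap.smul_apply,
    LinearMap.sum_apply]
  rfl

variable (hα0 : 0 < α)

include hα0

theorem exists_hasTrajectoryExp_inner_gradEstimate (x : JointPolicy N S A) (i : N)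
    (p q : Policy S (A i)) :
    ∃ u, G.HasTrajectoryExp (greedyProfile hα x)
        (fun l => inner ℝ (G.gradEstimate α i (x i) l) (p.1 - q.1)) u ∧
      probVec G.init ⬝ᵥ u =
        G.policyGradient i (greedyProfile hα x) ((greedy α hα p).1 - (greedy α hα q).1) := by
  have hcentred : ∀ s, profileProb (greedyProfile hα x) s ⬝ᵥ score hα (x i) (p.1 - q.1) s = 0 :=
    fun s => by
      change ∑ a, (profileProb (greedyProfile hα x) s * score hα (x i) (p.1 - q.1) s) a = 0
      rw [profileProb_mul_score hα hα0, map_sub, ← profileProb_update, ← profileProb_update]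
      simp [← Finset.mul_sum, (profileProb_mem_stdSimplex _ s).2]
  obtain ⟨u, hu, hbellman⟩ := exists_hasTrajectoryExp_reward_mul (G := G) i hcentred
  refine ⟨u, by simpa only [G.inner_gradEstimate hα hα0] using hu, ?_⟩
  have hadvantage : (fun s => profileProb (greedyProfile hα x) s ⬝ᵥ
      (score hα (x i) (p.1 - q.1) s * G.actionValue i (greedyProfile hα x) s)) =
        (1 - α) • G.deviationAdvantage i (greedyProfile hα x) (p.1 - q.1) := by
    funext s
    calc _ = (profileProb (greedyProfile hα x) s * score hα (x i) (p.1 - q.1) s) ⬝ᵥ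
          G.actionValue i (greedyProfile hα x) s := by
          simp only [dotProduct, Pi.mul_apply, mul_assoc]
      _ = _ := by
          rw [profileProb_mul_score hα hα0, smul_dotProduct]
          rfl
  have hvisit := G.visitation_dotProduct_sub (greedyProfile hα x) G.init u
  rw [hbellman, hadvantage, dotProduct_smul, smul_eq_mul] at hvisit
  rw [greedy_sub_greedy, map_smul, policyGradient_apply, smul_eq_mul, mul_left_comm, hvisit,
    inv_mul_cancel_left₀ G.one_sub_discount_pos.ne']

theorem pathExp_norm_gradEstimate_sq_le (x : JointPolicy N S A) (i : N) (k : ℕ) (s : S) :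
    G.pathExp (greedyProfile hα x) k (fun l => ‖G.gradEstimate α i (x i) l‖ ^ 2) s ≤
      maxActions N A ^ 2 / α * ((k : ℝ) + 1) ^ 4 := by
  set h : S → (∀ i, A i) → ℝ := fun s a => ((1 - α) / (greedy α hα (x i)).1 (s, a i)) ^ 2
  calc G.pathExp (greedyProfile hα x) k (fun l => ‖G.gradEstimate α i (x i) l‖ ^ 2) s
      ≤ G.pathExp (greedyProfile hα x) k (((k : ℝ) + 1) ^ 3 • pathSum h) s :=
        G.pathExp_mono _ k (fun l hl => by
          simpa [hl] using G.norm_gradEstimate_sq_le hα hα0 i (x i) l) s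
    _ ≤ ((k : ℝ) + 1) ^ 3 * (maxActions N A ^ 2 / α * (k + 1)) := by
        rw [map_smul, Pi.smul_apply, smul_eq_mul]
        gcongr
        exact G.pathExp_pathSum_le _ (profileProb_dotProduct_score_sq_le hα hα0 x i) k s
    _ = maxActions N A ^ 2 / α * ((k : ℝ) + 1) ^ 4 := by ring

theorem exists_hasTrajectoryExp_norm_gradEstimate_sq (x : JointPolicy N S A) (i : N) :
    ∃ u, G.HasTrajectoryExp (greedyProfile hα x)
        (fun l => ‖G.gradEstimate α i (x i) l‖ ^ 2) u ∧
      ∀ s, u s ≤ 24 * maxActions N A ^ 2 / (α * (1 - G.discount) ^ 4) := by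
  obtain ⟨C, hC, hle⟩ := exists_forall_abs_le
    fun s a => ((1 - α) / (greedy α hα (x i)).1 (s, a i)) ^ 2
  obtain ⟨u, hu⟩ := G.exists_hasTrajectoryExp (greedyProfile hα x) 4 hC
    (f := fun l => ‖G.gradEstimate α i (x i) l‖ ^ 2) fun l => by
      rw [abs_of_nonneg (sq_nonneg _)]
      refine (G.norm_gradEstimate_sq_le hα hα0 i (x i) l).trans ?_
      refine (mul_le_mul_of_nonneg_left ((le_abs_self _).trans (abs_pathSum_le hle l))
        (by positivity)).trans_eq ?_
      ring
  refine ⟨u, hu, fun s => (hu.le_of_pathExp_le 4 (by positivity)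
    (G.pathExp_norm_gradEstimate_sq_le hα hα0 x i) s).trans_eq ?_⟩
  norm_num [Nat.factorial]
  field_simp

theorem exists_hasTrajectoryExp_inner_jointGradEstimate (x y z : JointPolicy N S A) :
    ∃ u, G.HasTrajectoryExp (greedyProfile hα x)
        (fun l => inner ℝ (G.jointGradEstimate α x l) (paramEmbed y - paramEmbed z)) u ∧
      probVec G.init ⬝ᵥ u = G.paramGradient hα x (paramEmbed y - paramEmbed z) := by
  choose u hu hmean using fun i =>
    G.exists_hasTrajectoryExp_inner_gradEstimate hα hα0 x i (y i) (z i)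
  refine ⟨∑ i, u i, ?_, ?_⟩
  · simpa only [inner_jointGradEstimate, Finset.sum_fn] using
      HasTrajectoryExp.sum fun i (_ : i ∈ Finset.univ) => hu i
  · rw [paramGradient_sub, dotProduct_sum, Finset.sum_congr rfl fun i _ => hmean i]

theorem exists_hasTrajectoryExp_norm_jointGradEstimate_sq (x : JointPolicy N S A) :
    ∃ u, G.HasTrajectoryExp (greedyProfile hα x)
        (fun l => ‖G.jointGradEstimate α x l‖ ^ 2) u ∧
      probVec G.init ⬝ᵥ u ≤ G.gradientMoment α := by
  choose u hu hbound using G.exists_hasTrajectoryExp_norm_gradEstimate_sq hα hα0 x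
  refine ⟨∑ i, u i, ?_, ?_⟩
  · simpa only [norm_jointGradEstimate_sq, Finset.sum_fn] using
      HasTrajectoryExp.sum fun i (_ : i ∈ Finset.univ) => hu i
  · rw [dotProduct_sum]
    refine (Finset.sum_le_sum fun i _ => dotProduct_le_dotProduct_of_nonneg_left (hbound i)
      (probVec_mem_stdSimplex _).1).trans_eq ?_
    simp only [dotProduct_const_of_mem_stdSimplex (probVec_mem_stdSimplex G.init),
      Finset.sum_const, Finset.card_univ, nsmul_eq_mul, gradientMoment]

theorem lexpect_quadratic_le (x z : JointPolicy N S A) {c₀ c₁ c₂ : ℝ} (hc₂ : 0 ≤ c₂)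
    (hf : ∀ l, 0 ≤ c₀ + c₁ * inner ℝ (G.jointGradEstimate α x l) (paramEmbed z - paramEmbed x) +
      c₂ * ‖G.jointGradEstimate α x l‖ ^ 2) :
    lexpect (G.trajectoryLaw (greedyProfile hα x)) (fun l => ENNReal.ofReal
      (c₀ + c₁ * inner ℝ (G.jointGradEstimate α x l) (paramEmbed z - paramEmbed x) +
        c₂ * ‖G.jointGradEstimate α x l‖ ^ 2)) ≤
      ENNReal.ofReal (c₀ + c₁ * G.paramGradient hα x (paramEmbed z - paramEmbed x) +
        c₂ * G.gradientMoment α) := by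
  obtain ⟨u, hu, hmean⟩ := G.exists_hasTrajectoryExp_inner_jointGradEstimate hα hα0 x z x
  obtain ⟨m, hm, hmoment⟩ := G.exists_hasTrajectoryExp_norm_jointGradEstimate_sq hα hα0 x
  have hquadratic := ((HasTrajectoryExp.const c₀).add (hu.const_smul c₁)).add (hm.const_smul c₂)
  refine (hquadratic.lexpect_ofReal hf).trans_le (ENNReal.ofReal_le_ofReal ?_)
  rw [dotProduct_add, dotProduct_add, dotProduct_smul, dotProduct_smul,
    dotProduct_const_of_mem_stdSimplex (probVec_mem_stdSimplex _), hmean, smul_eq_mul, smul_eq_mul]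
  gcongr

end GradientEstimate

end Game

section Descent

theorem add_sum_Icc_le_of_descent {M : Type*} [AddCommMonoid M] [PartialOrder M]
    [IsOrderedAddMonoid M] {a e : ℕ → M} {b R : M} (hstep : ∀ t, a (t + 1) + e t ≤ a t + b)
    (hstart : a 1 ≤ R) (T : ℕ) : a (T + 1) + ∑ t ∈ Finset.Icc 1 T, e t ≤ R + T • b := by
  induction T with
  | zero => simpa using hstart
  | succ T ih =>
    calc a (T + 1 + 1) + ∑ t ∈ Finset.Icc 1 (T + 1), e t
        = a (T + 1 + 1) + e (T + 1) + ∑ t ∈ Finset.Icc 1 T, e t := by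
          rw [Finset.sum_Icc_succ_top (Nat.le_add_left 1 T)]
          abel
      _ ≤ a (T + 1) + b + ∑ t ∈ Finset.Icc 1 T, e t := by grw [hstep]
      _ = a (T + 1) + ∑ t ∈ Finset.Icc 1 T, e t + b := by abel
      _ ≤ R + T • b + b := by grw [ih]
      _ = R + (T + 1) • b := by rw [succ_nsmul, add_assoc]

theorem exists_nsmul_le_of_descent {M : Type*} [AddCommMonoid M] [LinearOrder M]
    [IsOrderedAddMonoid M] [CanonicallyOrderedAdd M] {a e : ℕ → M} {b R : M}
    (hstep : ∀ t, a (t + 1) + e t ≤ a t + b) (hstart : a 1 ≤ R) {T : ℕ} (hT : 0 < T) :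
    ∃ t ∈ Finset.Icc 1 T, T • e t ≤ R + T • b := by
  obtain ⟨t, ht, hmin⟩ := (Finset.Icc 1 T).exists_min_image e (Finset.nonempty_Icc.2 hT)
  refine ⟨t, ht, ?_⟩
  calc T • e t ≤ ∑ t ∈ Finset.Icc 1 T, e t := by
        simpa using Finset.card_nsmul_le_sum _ e (e t) hmin
    _ ≤ R + T • b := le_add_self.trans (add_sum_Icc_le_of_descent hstep hstart T)

end Descent

namespace Game

section StochasticAscent

variable {N S : Type*} {A : N → Type*} [Fintype N] [∀ i, Fintype (A i)]
  {G : Game N S A}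

variable (G) in
/-- A Lipschitz constant for the gradient of `greedyPotential`. -/
def smoothness : ℝ := 4 * Fintype.card N * maxActions N A / (1 - G.discount) ^ 3

theorem smoothness_nonneg : 0 ≤ G.smoothness := by
  have hp := G.one_sub_discount_pos
  unfold smoothness
  positivity

variable (G) in
/-- The bound that `T` steps of size `η` give for the mean squared distance from a parameter to a
proximal point, if the potential has range `R`. -/
def meanSquareBound (α η R : ℝ) (T : ℕ) : ℝ :=
  (R / T + G.smoothness * η ^ 2 * G.gradientMoment α) / (2 * G.smoothness ^ 2 * η)

theorem meanSquareBound_nonneg {α η R : ℝ} (hα : 0 ≤ α) (hη : 0 ≤ η) (hR : 0 ≤ R) (T : ℕ) :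
    0 ≤ G.meanSquareBound α η R T := by
  have hβ := smoothness_nonneg (G := G)
  have hmoment := G.gradientMoment_nonneg hα
  unfold meanSquareBound
  positivity

variable [∀ i, Nonempty (A i)]

theorem smoothness_pos [Nonempty N] : 0 < G.smoothness := by
  have hp := G.one_sub_discount_pos
  have hA := one_le_maxActions N A
  unfold smoothness
  positivity

variable [Fintype S] {Φ : S → JointPolicy N S A → ℝ} {α : ℝ}

theorem policyDist_greedyProfile_le (hα : α ∈ Set.Icc (0 : ℝ) 1) (x y : JointPolicy N S A) :
    policyDist (greedyProfile hα y) (greedyProfile hα x) ≤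
      √(Fintype.card N * maxActions N A) * ‖paramEmbed y - paramEmbed x‖ := by
  have hrow : ∀ j, rowNorm ((greedy α hα (y j)).1 - (greedy α hα (x j)).1) ≤
      √(maxActions N A) * ‖(y j).1 - (x j).1‖ := fun j => by
    grw [rowNorm_le_sqrt_card_mul_norm, norm_greedy_sub_greedy_le, card_le_maxActions]
  have hcauchy : ∑ j, ‖(y j).1 - (x j).1‖ ≤ √(Fintype.card N) * ‖paramEmbed y - paramEmbed x‖ := by
    rw [← Real.sqrt_sq (norm_nonneg (paramEmbed y - paramEmbed x)), ← Real.sqrt_mul (by positivity),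
      norm_paramEmbed_sub_sq]
    exact Real.le_sqrt_of_sq_le sq_sum_le_card_mul_sum_sq
  calc policyDist (greedyProfile hα y) (greedyProfile hα x)
      ≤ √(maxActions N A) * ∑ j, ‖(y j).1 - (x j).1‖ := by
        rw [Finset.mul_sum]
        exact Finset.sum_le_sum fun j _ => hrow j
    _ ≤ √(maxActions N A) * (√(Fintype.card N) * ‖paramEmbed y - paramEmbed x‖) := by grw [hcauchy]
    _ = √(Fintype.card N * maxActions N A) * ‖paramEmbed y - paramEmbed x‖ := by
        rw [Real.sqrt_mul (by positivity)]
        ring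

variable [DecidableEq N] (hα : α ∈ Set.Icc (0 : ℝ) 1)

variable (G) in
/-- The mean potential as a function of the parameters of the `α`-greedy policies: the objective of
the stochastic ascent. -/
def greedyPotential (Φ : S → JointPolicy N S A → ℝ) (x : JointPolicy N S A) : ℝ :=
  G.meanPotential Φ (greedyProfile hα x)

variable (hΦ : G.IsPotential Φ)
include hΦ

theorem IsPotential.abs_greedyPotential_sub_sub_le (x y : JointPolicy N S A) :
    |G.greedyPotential hα Φ y - G.greedyPotential hα Φ x -
        G.paramGradient hα x (paramEmbed y - paramEmbed x)| ≤
      G.smoothness / 2 * ‖paramEmbed y - paramEmbed x‖ ^ 2 := by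
  have hp := G.one_sub_discount_pos
  rw [paramGradient_sub]
  calc _ ≤ 2 * policyDist (greedyProfile hα y) (greedyProfile hα x) ^ 2 / (1 - G.discount) ^ 3 :=
        hΦ.abs_meanPotential_sub_sub_le _ _
    _ ≤ 2 * (√(Fintype.card N * maxActions N A) * ‖paramEmbed y - paramEmbed x‖) ^ 2 /
          (1 - G.discount) ^ 3 := by
        gcongr
        exacts [policyDist_nonneg _ _, policyDist_greedyProfile_le hα x y]
    _ = G.smoothness / 2 * ‖paramEmbed y - paramEmbed x‖ ^ 2 := by
        rw [mul_pow, Real.sq_sqrt (by positivity), smoothness]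
        ring

theorem IsPotential.continuous_greedyPotential : Continuous (G.greedyPotential hα Φ) := by
  refine continuous_iff_continuousAt.2 fun x => tendsto_iff_dist_tendsto_zero.2 ?_
  have hlinear : Continuous (G.paramGradient hα x) := LinearMap.continuous_of_finiteDimensional _
  have hembed := continuous_paramEmbed (N := N) (S := S) (A := A)
  have hbound : Continuous fun y => |G.paramGradient hα x (paramEmbed y - paramEmbed x)| +
      G.smoothness / 2 * ‖paramEmbed y - paramEmbed x‖ ^ 2 := by fun_prop
  refine squeeze_zero (fun _ => dist_nonneg) (fun y => ?_)
    (by simpa only [sub_self, map_zero, abs_zero, norm_zero, zero_pow two_ne_zero, mul_zero,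
      add_zero] using hbound.tendsto x)
  rw [Real.dist_eq, ← sub_le_iff_le_add']
  exact (abs_sub_abs_le_abs_sub _ _).trans (hΦ.abs_greedyPotential_sub_sub_le hα x y)

theorem IsPotential.exists_isProximalPoint (x : JointPolicy N S A) :
    ∃ z, IsProximalPoint paramEmbed (G.greedyPotential hα Φ) G.smoothness x z :=
  MarkovGame.exists_isProximalPoint continuous_paramEmbed (hΦ.continuous_greedyPotential hα) _ x

theorem IsPotential.greedyPotential_le_add_potentialRange (x y : JointPolicy N S A) :
    G.greedyPotential hα Φ y ≤ G.greedyPotential hα Φ x + G.potentialRange Φ :=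
  sub_le_iff_le_add'.1 (hΦ.meanPotential_sub_le_potentialRange _ _)

omit hΦ in
variable (G) in
/-- The Lyapunov function of the stochastic ascent: how far the Moreau envelope of the potential is
below its maximum. -/
def envelopeDeficit (Φ : S → JointPolicy N S A → ℝ) (x : JointPolicy N S A) : ℝ :=
  (⨆ y, G.greedyPotential hα Φ y) -
    moreauEnvelope paramEmbed (G.greedyPotential hα Φ) G.smoothness x

theorem IsPotential.envelopeDeficit_nonneg (x : JointPolicy N S A) :
    0 ≤ G.envelopeDeficit hα Φ x := by
  obtain ⟨z, hz⟩ := hΦ.exists_isProximalPoint hα x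
  have hle : G.greedyPotential hα Φ z ≤ ⨆ y, G.greedyPotential hα Φ y :=
    le_ciSup ⟨_, Set.forall_mem_range.2 (hΦ.greedyPotential_le_add_potentialRange hα x)⟩ z
  have hpenalty := mul_nonneg (smoothness_nonneg (G := G))
    (sq_nonneg ‖paramEmbed z - paramEmbed x‖)
  rw [envelopeDeficit, hz.moreauEnvelope_eq]
  linarith

theorem IsPotential.envelopeDeficit_le_potentialRange (x : JointPolicy N S A) :
    G.envelopeDeficit hα Φ x ≤ G.potentialRange Φ := by
  obtain ⟨z, hz⟩ := hΦ.exists_isProximalPoint hα x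
  have := Nonempty.intro x
  have hle := ciSup_le (hΦ.greedyPotential_le_add_potentialRange hα x)
  have hself := hz.le_moreauEnvelope x
  rw [sub_self, norm_zero] at hself
  rw [envelopeDeficit]
  linarith

theorem IsPotential.envelopeDeficit_step_le (η : ℝ) {x z : JointPolicy N S A}
    (hz : IsProximalPoint paramEmbed (G.greedyPotential hα Φ) G.smoothness x z)
    (l : List (S × ∀ i, A i)) :
    G.envelopeDeficit hα Φ (G.step α η x l) ≤ G.envelopeDeficit hα Φ x +
      -(2 * G.smoothness * η) *
        inner ℝ (G.jointGradEstimate α x l) (paramEmbed z - paramEmbed x) +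
      G.smoothness * η ^ 2 * ‖G.jointGradEstimate α x l‖ ^ 2 := by
  obtain ⟨w, hw⟩ := hΦ.exists_isProximalPoint hα (G.step α η x l)
  have hcompare := hw.le_moreauEnvelope z
  have hstep := mul_le_mul_of_nonneg_left (G.norm_paramEmbed_sub_step_sq_le α η x z l)
    (smoothness_nonneg (G := G))
  rw [norm_sub_sq_real _ (η • _), inner_smul_right, real_inner_comm, norm_smul, mul_pow,
    Real.norm_eq_abs, sq_abs] at hstep
  rw [envelopeDeficit, envelopeDeficit, hz.moreauEnvelope_eq]
  linarith

variable (hα0 : 0 < α) {η : ℝ} (hη : 0 < η)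
include hα0 hη

theorem IsPotential.lexpect_envelopeDeficit_step_add_le {x z : JointPolicy N S A}
    (hz : IsProximalPoint paramEmbed (G.greedyPotential hα Φ) G.smoothness x z) :
    lexpect (G.trajectoryLaw (greedyProfile hα x))
        (fun l => ENNReal.ofReal (G.envelopeDeficit hα Φ (G.step α η x l))) +
      ENNReal.ofReal (2 * G.smoothness ^ 2 * η) *
        ENNReal.ofReal (‖paramEmbed z - paramEmbed x‖ ^ 2) ≤
    ENNReal.ofReal (G.envelopeDeficit hα Φ x) +
      ENNReal.ofReal (G.smoothness * η ^ 2 * G.gradientMoment α) := by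
  have hβ := smoothness_nonneg (G := G)
  have hnonneg := hΦ.envelopeDeficit_nonneg hα
  have hmoment := G.gradientMoment_nonneg hα.1
  have hascent : -(2 * G.smoothness * η) * G.paramGradient hα x (paramEmbed z - paramEmbed x) ≤
      -(2 * G.smoothness ^ 2 * η * ‖paramEmbed z - paramEmbed x‖ ^ 2) := by
    have hgrad := hz.mul_norm_sq_le (fun y t ht => exists_paramEmbed_segment z y ht)
      (hΦ.abs_greedyPotential_sub_sub_le hα)
    linarith [mul_le_mul_of_nonneg_left hgrad (by positivity : 0 ≤ 2 * G.smoothness * η)]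
  set K := 2 * G.smoothness ^ 2 * η * ‖paramEmbed z - paramEmbed x‖ ^ 2 with hK
  have hK0 : 0 ≤ K := by positivity
  have hstep' : ∀ l, G.envelopeDeficit hα Φ (G.step α η x l) + K ≤
      (G.envelopeDeficit hα Φ x + K) + -(2 * G.smoothness * η) *
        inner ℝ (G.jointGradEstimate α x l) (paramEmbed z - paramEmbed x) +
      G.smoothness * η ^ 2 * ‖G.jointGradEstimate α x l‖ ^ 2 := fun l => by
    linarith [hΦ.envelopeDeficit_step_le hα η hz l]
  rw [← ENNReal.ofReal_mul (by positivity), ← hK, ← lexpect_const (G.trajectoryLaw _)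
    (ENNReal.ofReal K), ← lexpect_add, ← ENNReal.ofReal_add (hnonneg x) (by positivity)]
  simp only [← ENNReal.ofReal_add (hnonneg _) hK0]
  refine (lexpect_mono _ fun l => ENNReal.ofReal_le_ofReal (hstep' l)).trans
    ((G.lexpect_quadratic_le hα hα0 x z (by positivity) fun l =>
      (add_nonneg (hnonneg _) hK0).trans (hstep' l)).trans (ENNReal.ofReal_le_ofReal ?_))
  linarith

theorem IsPotential.lexpect_iterateLaw_succ_add_le {Z : JointPolicy N S A → JointPolicy N S A}
    (hZ : ∀ x, IsProximalPoint paramEmbed (G.greedyPotential hα Φ) G.smoothness x (Z x))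
    (x₀ : JointPolicy N S A) (t : ℕ) :
    lexpect (G.iterateLaw α hα η x₀ (t + 1))
        (fun x => ENNReal.ofReal (G.envelopeDeficit hα Φ x)) +
      ENNReal.ofReal (2 * G.smoothness ^ 2 * η) * lexpect (G.iterateLaw α hα η x₀ t)
        (fun x => ENNReal.ofReal (‖paramEmbed (Z x) - paramEmbed x‖ ^ 2)) ≤
    lexpect (G.iterateLaw α hα η x₀ t) (fun x => ENNReal.ofReal (G.envelopeDeficit hα Φ x)) +
      ENNReal.ofReal (G.smoothness * η ^ 2 * G.gradientMoment α) := by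
  rw [iterateLaw, lexpect_bind, ← lexpect_const_mul, ← lexpect_add,
    ← lexpect_const (G.iterateLaw α hα η x₀ t) (ENNReal.ofReal (_ * G.gradientMoment α)),
    ← lexpect_add]
  refine lexpect_mono _ fun x => ?_
  rw [lexpect_map]
  exact hΦ.lexpect_envelopeDeficit_step_add_le hα hα0 hη (hZ x)

theorem IsPotential.exists_lexpect_norm_sq_le [Nonempty N]
    {Z : JointPolicy N S A → JointPolicy N S A}
    (hZ : ∀ x, IsProximalPoint paramEmbed (G.greedyPotential hα Φ) G.smoothness x (Z x))
    (x₀ : JointPolicy N S A) {T : ℕ} (hT : 0 < T) :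
    ∃ t ∈ Finset.Icc 1 T, lexpect (G.iterateLaw α hα η x₀ t)
        (fun x => ENNReal.ofReal (‖paramEmbed (Z x) - paramEmbed x‖ ^ 2)) ≤
      ENNReal.ofReal (G.meanSquareBound α η (G.potentialRange Φ) T) := by
  have hβ := smoothness_pos (G := G)
  have hT' : (0 : ℝ) < T := Nat.cast_pos.2 hT
  have hmoment := G.gradientMoment_nonneg hα.1
  have hrange := hΦ.potentialRange_nonneg x₀
  have hstart : lexpect (G.iterateLaw α hα η x₀ 1)
      (fun x => ENNReal.ofReal (G.envelopeDeficit hα Φ x)) ≤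
        ENNReal.ofReal (G.potentialRange Φ) :=
    (lexpect_mono _ fun x => ENNReal.ofReal_le_ofReal
      (hΦ.envelopeDeficit_le_potentialRange hα x)).trans_eq (lexpect_const _ _)
  obtain ⟨t, ht, hle⟩ := exists_nsmul_le_of_descent (a := fun t => lexpect
    (G.iterateLaw α hα η x₀ t) fun x => ENNReal.ofReal (G.envelopeDeficit hα Φ x))
    (hΦ.lexpect_iterateLaw_succ_add_le hα hα0 hη hZ x₀) hstart hT
  refine ⟨t, ht, ?_⟩
  rw [nsmul_eq_mul, nsmul_eq_mul, ← ENNReal.ofReal_natCast, ← mul_assoc,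
    ← ENNReal.ofReal_mul hT'.le, ← ENNReal.ofReal_mul hT'.le,
    ← ENNReal.ofReal_add hrange (by positivity)] at hle
  have hc : 0 < T * (2 * G.smoothness ^ 2 * η) := by positivity
  rw [meanSquareBound, ← mul_div_mul_left _ _ hT'.ne', mul_add, mul_div_cancel₀ _ hT'.ne',
    ENNReal.ofReal_div_of_pos hc]
  exact (ENNReal.le_div_iff_mul_le (.inl (ENNReal.ofReal_pos.2 hc).ne')
    (.inl ENNReal.ofReal_ne_top)).2 ((mul_comm _ _).trans_le hle)

end StochasticAscent

end Game

section Iterations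

theorem iterations_pos (ε γ D R : ℝ) (n a s : ℕ) : 0 < iterations ε γ D R n a s :=
  lt_max_of_lt_left one_pos

theorem div_iterations_le {ε γ D : ℝ} (hε : 0 < ε) (hγ : γ < 1) (hD : 0 < D) {n a s : ℕ}
    (hn : 0 < n) (ha : 0 < a) (hs : 0 < s) (R : ℝ) :
    R / iterations ε γ D R n a s ≤
      (1 - γ) ^ 11 * ε ^ 6 / (10 ^ 8 * n ^ 2 * a ^ 3 * D ^ 4 * s ^ 2) := by
  have hp := sub_pos.2 hγ
  have hle : 10 ^ 8 * n ^ 2 * a ^ 3 * R * D ^ 4 * s ^ 2 / ((1 - γ) ^ 11 * ε ^ 6) ≤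
      iterations ε γ D R n a s :=
    (Nat.le_ceil _).trans (Nat.cast_le.2 (le_max_right _ _))
  have hpos : (0 : ℝ) < iterations ε γ D R n a s := Nat.cast_pos.2 (iterations_pos ..)
  rw [div_le_iff₀ (by positivity)] at hle
  rw [div_le_div_iff₀ hpos (by positivity)]
  linarith

end Iterations

namespace Game

section Parameters

variable {N S : Type*} {A : N → Type*} [Fintype N] [DecidableEq N] [Fintype S]
  [∀ i, Fintype (A i)] [∀ i, Nonempty (A i)] {G : Game N S A} {Φ : S → JointPolicy N S A → ℝ}
  {I : Set (PMF S)}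

variable (G) in
/-- The rate at which the Nash gap grows with the distance from a parameter to a proximal point. -/
def gapConstant (I : Set (PMF S)) : ℝ :=
  4 * G.mismatch I * G.smoothness * √(Fintype.card S) / (1 - G.discount) +
    2 * √(Fintype.card N * maxActions N A) / (1 - G.discount) ^ 2

theorem IsPotential.policyGradient_greedy_sub_le (hΦ : G.IsPotential Φ) {α : ℝ}
    (hα : α ∈ Set.Icc (0 : ℝ) 1) {x z : JointPolicy N S A}
    (hz : IsProximalPoint paramEmbed (G.greedyPotential hα Φ) G.smoothness x z) (i : N)
    (y : Policy S (A i)) :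
    G.policyGradient i (greedyProfile hα z) ((greedy α hα y).1 - (greedy α hα (z i)).1) ≤
      4 * G.smoothness * √(Fintype.card S) * ‖paramEmbed z - paramEmbed x‖ := by
  have hβ := smoothness_nonneg (G := G)
  have hopt := hz.le_inner (fun y t ht => exists_paramEmbed_segment z y ht)
    (hΦ.abs_greedyPotential_sub_sub_le hα z) (Function.update z i y)
  rw [paramGradient_sub, Finset.sum_eq_single i (fun j _ hj => by
    rw [Function.update_of_ne hj, sub_self, map_zero]) (by simp), Function.update_self] at hopt
  calc _ ≤ 2 * G.smoothness * inner ℝ (paramEmbed z - paramEmbed x)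
          (paramEmbed (Function.update z i y) - paramEmbed z) := hopt
    _ ≤ 2 * G.smoothness * (‖paramEmbed z - paramEmbed x‖ * (2 * √(Fintype.card S))) := by
        grw [real_inner_le_norm, norm_paramEmbed_update_sub_le]
    _ = 4 * G.smoothness * √(Fintype.card S) * ‖paramEmbed z - paramEmbed x‖ := by ring

theorem IsPotential.nashGap_greedy_le_gapConstant_mul (hΦ : G.IsPotential Φ)
    (hI : ∀ ν ∈ I, ∀ (π : JointPolicy N S A) (s : S), G.init s = 0 → G.visitation π ν s = 0)
    (hne : I.Nonempty) {α : ℝ} (hα : α ∈ Set.Icc (0 : ℝ) 1) {x z : JointPolicy N S A}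
    (hz : IsProximalPoint paramEmbed (G.greedyPotential hα Φ) G.smoothness x z) :
    G.nashGap I (greedyProfile hα x) ≤ 2 * α / (1 - G.discount) ^ 2 +
      G.gapConstant I * ‖paramEmbed z - paramEmbed x‖ := by
  have hp := G.one_sub_discount_pos
  have hβ := smoothness_nonneg (G := G)
  refine (nashGap_greedy_le hI hne hα x z (by positivity)
    (hΦ.policyGradient_greedy_sub_le hα hz)).trans ?_
  grw [policyDist_greedyProfile_le hα z x, norm_sub_rev (paramEmbed x)]
  exact le_of_eq (by rw [gapConstant]; ring)

variable [Nonempty N]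

theorem gapConstant_sq_le (hD : 1 ≤ G.mismatch I) :
    G.gapConstant I ^ 2 ≤ 324 * Fintype.card N ^ 2 * maxActions N A ^ 2 * Fintype.card S *
      G.mismatch I ^ 2 / (1 - G.discount) ^ 8 := by
  have hp := G.one_sub_discount_pos
  have hp1 : 1 - G.discount ≤ 1 := by linarith [G.discount_nonneg]
  have hβ := smoothness_nonneg (G := G)
  have hn : (1 : ℝ) ≤ Fintype.card N := Nat.one_le_cast.2 Fintype.card_pos
  have ha : (1 : ℝ) ≤ maxActions N A := Nat.one_le_cast.2 (one_le_maxActions N A)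
  have hs : 1 ≤ √(Fintype.card S) := Real.one_le_sqrt.2 (Nat.one_le_cast.2 G.one_le_card_state)
  set B : ℝ := Fintype.card N * maxActions N A * √(Fintype.card S) * G.mismatch I with hB
  have hna : 1 ≤ (Fintype.card N : ℝ) * maxActions N A := one_le_mul_of_one_le_of_one_le hn ha
  have hroot : √(Fintype.card N * maxActions N A) ≤ B := by
    calc √(Fintype.card N * maxActions N A) ≤ Fintype.card N * maxActions N A :=
          Real.sqrt_le_iff.2 ⟨by positivity, le_self_pow₀ hna two_ne_zero⟩
      _ ≤ Fintype.card N * maxActions N A * (√(Fintype.card S) * G.mismatch I) :=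
          le_mul_of_one_le_right (by positivity) (one_le_mul_of_one_le_of_one_le hs hD)
      _ = B := by ring
  have hsum : G.gapConstant I ≤ 18 * B / (1 - G.discount) ^ 4 := by
    calc G.gapConstant I ≤ 16 * B / (1 - G.discount) ^ 4 + 2 * B / (1 - G.discount) ^ 4 := by
          rw [gapConstant, smoothness]
          refine add_le_add (le_of_eq (by rw [hB]; field_simp; ring)) ?_
          gcongr ?_ / ?_
          · gcongr
          · exact pow_le_pow_of_le_one hp.le hp1 (by norm_num)
      _ = 18 * B / (1 - G.discount) ^ 4 := by ring
  have hD0 : 0 ≤ G.mismatch I := by linarith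
  calc G.gapConstant I ^ 2 ≤ (18 * B / (1 - G.discount) ^ 4) ^ 2 :=
        pow_le_pow_left₀ (by unfold gapConstant; positivity) hsum 2
    _ = _ := by
        rw [hB, div_pow, mul_pow, mul_pow _ (G.mismatch I), mul_pow _ √_,
          Real.sq_sqrt (Nat.cast_nonneg _)]
        ring

theorem stepSize_mismatch_pos {ε : ℝ} (hε : 0 < ε) (hD : 1 ≤ G.mismatch I) :
    0 < stepSize ε G.discount (G.mismatch I) (Fintype.card N) (maxActions N A)
      (Fintype.card S) := by
  have hp := G.one_sub_discount_pos
  have ha := one_le_maxActions N A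
  have hs := G.one_le_card_state
  unfold stepSize
  positivity

theorem gapConstant_sq_mul_meanSquareBound_le {ε : ℝ} (hε : 0 < ε) (hD : 1 ≤ G.mismatch I) {R η : ℝ}
    (hη : η = stepSize ε G.discount (G.mismatch I) (Fintype.card N) (maxActions N A)
      (Fintype.card S)) {T : ℕ}
    (hT : T = iterations ε G.discount (G.mismatch I) R (Fintype.card N) (maxActions N A)
      (Fintype.card S)) :
    G.gapConstant I ^ 2 * G.meanSquareBound (ε ^ 2) η R T ≤ ε ^ 2 / 4 := by
  have hp := G.one_sub_discount_pos
  have hη0 := hη.symm ▸ stepSize_mismatch_pos hε hD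
  have hn : 0 < Fintype.card N := Fintype.card_pos
  have ha := one_le_maxActions N A
  have hs := G.one_le_card_state
  have hβ := smoothness_pos (G := G)
  have hmoment := G.gradientMoment_nonneg (sq_nonneg ε)
  grw [meanSquareBound, hT, div_iterations_le hε G.discount_lt_one (by linarith) hn ha hs,
    gapConstant_sq_le hD]
  refine le_of_eq_of_le (b := (324 / 32 / 10 ^ 3 + 324 * 3 / 10 ^ 5) * ε ^ 2) ?_
    (by linarith [sq_nonneg ε])
  rw [hη, smoothness, gradientMoment, stepSize]
  field_simp
  ring

theorem gapBound_schedule_le {ε : ℝ} (hε : 0 < ε) (hε' : ε ≤ (1 - G.discount) ^ 2 / 4)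
    (hD : 1 ≤ G.mismatch I) {R η : ℝ}
    (hη : η = stepSize ε G.discount (G.mismatch I) (Fintype.card N) (maxActions N A)
      (Fintype.card S)) {T : ℕ}
    (hT : T = iterations ε G.discount (G.mismatch I) R (Fintype.card N) (maxActions N A)
      (Fintype.card S)) :
    2 * ε ^ 2 / (1 - G.discount) ^ 2 + ε / 4 +
      G.gapConstant I ^ 2 * G.meanSquareBound (ε ^ 2) η R T / (4 * (ε / 4)) ≤ ε := by
  have hp := G.one_sub_discount_pos
  have hexplore : 2 * ε ^ 2 / (1 - G.discount) ^ 2 ≤ ε / 2 := by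
    rw [div_le_iff₀ (by positivity), sq]
    linarith [mul_le_mul_of_nonneg_left hε' hε.le]
  have hdist :
      G.gapConstant I ^ 2 * G.meanSquareBound (ε ^ 2) η R T / (4 * (ε / 4)) ≤ ε / 4 := by
    rw [mul_div_cancel₀ _ four_ne_zero, div_le_iff₀ hε, div_mul_eq_mul_div, ← sq]
    exact gapConstant_sq_mul_meanSquareBound_le hε hD hη hT
  linarith

end Parameters

end Game
end

end MarkovGame

theorem mainTheorem2 {N S : Type*} {A : N → Type*} [Fintype N] [DecidableEq N] [Nonempty N]
    [Fintype S] [∀ i, Fintype (A i)] [∀ i, Nonempty (A i)]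
    (G : MarkovGame.Game N S A) (Φ : S → MarkovGame.JointPolicy N S A → ℝ)
    (hΦ : G.IsPotential Φ)
    (I : Set (PMF S)) (hI : I.Nonempty)
    (hD : ∀ ν ∈ I, ∀ (π : MarkovGame.JointPolicy N S A) (s : S),
      G.init s = 0 → G.visitation π ν s = 0)
    (ε : ℝ) (hε : 0 < ε) (hε' : ε ≤ (1 - G.discount) ^ 2 / 4)
    (α : ℝ) (hα : α ∈ Set.Icc (0 : ℝ) 1) (hαε : α = ε ^ 2)
    (η : ℝ) (hη : η = MarkovGame.stepSize ε G.discount (G.mismatch I)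
      (Fintype.card N) (MarkovGame.maxActions N A) (Fintype.card S))
    (T : ℕ) (hT : T = MarkovGame.iterations ε G.discount (G.mismatch I) (G.potentialRange Φ)
      (Fintype.card N) (MarkovGame.maxActions N A) (Fintype.card S))
    (x₀ : MarkovGame.JointPolicy N S A) :
    ∃ t ∈ Finset.Icc 1 T,
      ∑' x : MarkovGame.JointPolicy N S A, G.iterateLaw α hα η x₀ t x *
        ENNReal.ofReal (G.nashGap I fun i => MarkovGame.greedy α hα (x i)) ≤ ENNReal.ofReal ε := by
  subst hαε
  have hD1 : 1 ≤ G.mismatch I := MarkovGame.Game.one_le_mismatch hD hI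
  have hη0 : 0 < η := hη ▸ MarkovGame.Game.stepSize_mismatch_pos hε hD1
  choose Z hZ using hΦ.exists_isProximalPoint hα
  obtain ⟨t, ht, hnear⟩ := hΦ.exists_lexpect_norm_sq_le hα (pow_pos hε 2) hη0 hZ x₀
    (hT ▸ MarkovGame.iterations_pos ..)
  have hgap x := hΦ.nashGap_greedy_le_gapConstant_mul hD hI hα (hZ x)
  have hp := G.one_sub_discount_pos
  have hbound : 0 ≤ G.meanSquareBound (ε ^ 2) η (G.potentialRange Φ) T :=
    MarkovGame.Game.meanSquareBound_nonneg hα.1 hη0.le (hΦ.potentialRange_nonneg x₀) T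
  exact ⟨t, ht, (MarkovGame.lexpect_ofReal_le_of_sq_le _ (div_pos hε four_pos) hgap hnear
    (by positivity) hbound).trans
      (ENNReal.ofReal_le_ofReal (MarkovGame.Game.gapBound_schedule_le hε hε' hD1 hη hT))⟩
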